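/- Let $A\in\mathbb R^{n\times n}$, $B,C^\top\in\mathbb R^{n}$, $D\in\mathbb R$ be a minimal realization (no realization has smaller state dimension) of the SISO transfer function $G(s)=C(sI-A)^{-1}B+D$, let $\varphi:\mathbb R\to\mathbb R$ be differentiable, and consider the Lur'e feedback system $$\dot x=Ax+Bu,\qquad y=Cx+Du,\qquad u=-\varphi(y).$$ Let $\lambda\ge 0$, let $K_1<K_2$ be real numbers, let $p\ge 0$ be an integer, and put $\Omega_\lambda=\{s\in\mathbb C:\operatorname{Re}s>-\lambda\}$. When $K_1,K_2\neq0$, let $$\mathfrak D(K_1,K_2)=\Big\{x+jy\in\mathbb C:\Big(x+\tfrac{K_1+K_2}{2K_1K_2}\Big)^2+y^2\le\Big(\tfrac{K_2-K_1}{2K_1K_2}\Big)^2\Big\}.$$ The Nyquist plot of $G$ along $\partial\Omega_\lambda$ is the closed curve $\omega\mapsto G(j\omega-\lambda)$, $\omega\in\mathbb R\cup\{\infty\}$, with $G(\infty)=D$, traversed from $\omega=-\infty$ to $\omega=+\infty$. Suppose that (i) $(\varphi'(y)\,\delta y-K_1\delta y)(\varphi'(y)\,\delta y-K_2\delta y)\le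 0$ for all $y,\delta y\in\mathbb R$, that is, $\varphi'(y)\in[K_1,K_2]$ for all $y$; (ii) $G$ has no poles on $\partial\Omega_\lambda$; (iii) the Nyquist plot of $G$ along $\partial\Omega_\lambda$ makes exactly $p-q$ clockwise encirclements of the point $-1/K_1$, where $q$ is the number of poles of $G$ in $\Omega_\lambda$, counted with multiplicity; (iv) one of the following holds: (a) $0<K_1<K_2$ and the Nyquist plot is disjoint from $\mathfrak D(K_1,K_2)$; (b) $K_1<0<K_2$ and the Nyquist plot is contained in the interior of $\mathfrak D(K_1,K_2)$; (c) $K_1<K_2<0$ and the Nyquist plot is disjoint from $\mathfrak D(K_1,K_2)$. Then the closed loop is strictly $p$-dominant with rate $\lambda$. Explicitly: for every $x\in\mathbb R^n$ the loop equations $y=Cx+Du$, $u=-\varphi(y)$ have exactly one solution $(y,u)$; the resulting closed-loop vector field $f(x)=Ax+Bu$ is differentiable; and there are a constant $\varepsilon>0$ and a symmetric matrix $P\in\mathbb R^{n\times n}$ with exactly $p$ negative and $n-p$ positive eigenvalues (counted with multiplicity) and no zero eigenvalue, such that for all $x,\delta x\in\mathbb R^n$, with $\dot{\delta x}=\partial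 f(x)\,\delta x$, $$\begin{bmatrix}\dot{\delta x}\\ \delta x\end{bmatrix}^{\top}\begin{bmatrix}0&P\\ P&2\lambda P+\varepsilon I\end{bmatrix}\begin{bmatrix}\dot{\delta x}\\ \delta x\end{bmatrix}\le 0 .$$ -/

import Mathlib

open scoped Matrix Topology

/-- Data of a SISO linear system `ẋ = A x + B u`, `y = C x + D u` with state space `ℝⁿ`. -/
structure SISOSystem (n : ℕ) where
  A : Matrix (Fin n) (Fin n) ℝ
  B : Fin n → ℝ
  C : Fin n → ℝ
  D : ℝ

namespace SISOSystem

variable {n : ℕ}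

/-- The transfer function `G(s) = C (s I - A)⁻¹ B + D`, as a rational function. The matrix
`s I - A` is invertible over `ℝ(s)`, its determinant being the characteristic polynomial of `A`. -/
noncomputable def transfer (S : SISOSystem n) : RatFunc ℝ :=
  (RatFunc.C ∘ S.C) ⬝ᵥ
      (Matrix.scalar (Fin n) (RatFunc.X : RatFunc ℝ) - S.A.map RatFunc.C)⁻¹ *ᵥ (RatFunc.C ∘ S.B)
    + RatFunc.C S.D

/-- `S` is a minimal realization: no system with the same transfer function has a state space of
smaller dimension. -/
def IsMinimal (S : SISOSystem n) : Prop :=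
  ∀ (m : ℕ) (T : SISOSystem m), T.transfer = S.transfer → n ≤ m

/-- The poles of the transfer function, with multiplicity: the complex roots of its reduced
denominator. -/
noncomputable def poles (S : SISOSystem n) : Multiset ℂ :=
  S.transfer.denom.aroots ℂ

end SISOSystem

/-- The Nyquist region `Ω_l = {s | Re (s + l) > 0}`. -/
def nyquistRegion (l : ℝ) : Set ℂ := {s | 0 < (s + (l : ℂ)).re}

namespace SISOSystem

variable {n : ℕ}

open scoped Classical in
/-- The number of poles of the transfer function in `Ω_l`, with multiplicity. -/
noncomputable def numPolesIn (S : SISOSystem n) (l : ℝ) : ℕ :=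
  S.poles.countP (fun s => s ∈ nyquistRegion l)

/-- The Nyquist curve along the boundary of `Ω_l`: the closed curve
`ω ↦ G(jω - l)`, `ω ∈ ℝ ∪ {∞}`, with `G(∞) = D`. -/
noncomputable def nyquistCurve (S : SISOSystem n) (l : ℝ) : OnePoint ℝ → ℂ
  | none => (S.D : ℂ)
  | some ω => S.transfer.eval (algebraMap ℝ ℂ) (Complex.I * (ω : ℂ) - (l : ℂ))

/-- The Nyquist plot: the set of points of the Nyquist curve, including `G(∞)`. -/
def nyquistPlot (S : SISOSystem n) (l : ℝ) : Set ℂ := Set.range (S.nyquistCurve l)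

end SISOSystem

/-- The closed curve `γ`, run through from `ω = -∞` to `ω = +∞`, avoids `z` and makes exactly `E`
clockwise encirclements of `z`: a continuous argument `θ` of `γ - z` changes in total
by `-2 π E`. -/
def ClockwiseEncirclements (γ : OnePoint ℝ → ℂ) (z : ℂ) (E : ℤ) : Prop :=
  (∀ t, γ t ≠ z) ∧
  ∃ (θ : ℝ → ℝ) (a b : ℝ), Continuous θ ∧
    (∀ ω : ℝ, γ (ω : OnePoint ℝ) - z
      = (‖γ (ω : OnePoint ℝ) - z‖ : ℂ) * Complex.exp ((θ ω : ℂ) * Complex.I)) ∧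
    Filter.Tendsto θ Filter.atBot (𝓝 a) ∧ Filter.Tendsto θ Filter.atTop (𝓝 b) ∧
    b - a = -(2 * Real.pi * (E : ℝ))

/-- The closed disc `𝔇(K₁, K₂)`. -/
def circleDisc (K₁ K₂ : ℝ) : Set ℂ :=
  {z | (z.re + (K₁ + K₂) / (2 * K₁ * K₂)) ^ 2 + z.im ^ 2 ≤ ((K₂ - K₁) / (2 * K₁ * K₂)) ^ 2}

/-- The (differentiable) static nonlinearity `φ` satisfies the differential sector condition
`∂φ(y) ∈ [K₁, K₂]`. -/
def DifferentialSector (K₁ K₂ : ℝ) (φ : ℝ → ℝ) : Prop :=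
  Differentiable ℝ φ ∧ ∀ y dy : ℝ,
    (deriv φ y * dy - K₁ * dy) * (deriv φ y * dy - K₂ * dy) ≤ 0

open scoped Classical in
/-- The inertia of a real square matrix: the numbers of eigenvalues with negative, zero and
positive real part, counted with algebraic multiplicity, in this order. -/
noncomputable def inertia {n : ℕ} (P : Matrix (Fin n) (Fin n) ℝ) : ℕ × ℕ × ℕ :=
  ((P.charpoly.aroots ℂ).countP (fun s => s.re < 0),
   (P.charpoly.aroots ℂ).countP (fun s => s.re = 0),
   (P.charpoly.aroots ℂ).countP (fun s => 0 < s.re))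

/-- The nonlinear system `ẋ = f(x)` is strictly `p`-dominant with rate `l`: some symmetric `P` of
inertia `(p, 0, n - p)` (so with `p` negative eigenvalues) and some `ε > 0` satisfy the conic
constraint along the prolonged system `ẋ = f(x)`, `δẋ = ∂f(x) δx`. -/
def StrictlyDominant {n : ℕ} (p : ℕ) (l : ℝ) (f : (Fin n → ℝ) → (Fin n → ℝ)) : Prop :=
  Differentiable ℝ f ∧
  ∃ (P : Matrix (Fin n) (Fin n) ℝ) (ε : ℝ), P.IsSymm ∧ inertia P = (p, 0, n - p) ∧ 0 < ε ∧
    ∀ x dx : Fin n → ℝ,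
      Sum.elim (fderiv ℝ f x dx) dx ⬝ᵥ
        (Matrix.fromBlocks 0 P P ((2 * l) • P + ε • (1 : Matrix (Fin n) (Fin n) ℝ)) *ᵥ
          Sum.elim (fderiv ℝ f x dx) dx) ≤ 0

/-- `f` is the vector field of the Lur'e feedback system
`ẋ = A x + B u`, `y = C x + D u`, `u = -φ(y)`: for each state `x` the loop equations have exactly
one solution `(y, u)`, and `f x = A x + B u` for this solution. -/
def IsLureVectorField {n : ℕ} (S : SISOSystem n) (φ : ℝ → ℝ)
    (f : (Fin n → ℝ) → (Fin n → ℝ)) : Prop :=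
  (∀ x : Fin n → ℝ, ∃! w : ℝ × ℝ, w.1 = S.C ⬝ᵥ x + S.D * w.2 ∧ w.2 = -φ w.1) ∧
  ∀ (x : Fin n → ℝ) (y u : ℝ), y = S.C ⬝ᵥ x + S.D * u → u = -φ y →
    f x = S.A *ᵥ x + u • S.B

/-!
The closed loop is dominated by means of a single quadratic form. Write `u` and `y` for input and
output of the linear part. The sector condition says `(u + K₁ y)(u + K₂ y) ≤ 0` for the differential
signals of the loop, so it suffices to find a symmetric `P` and `ε > 0` with
`2 xᵀ P ((A + l I) x + B u) - (u + K₁ y)(u + K₂ y) ≤ -ε |x|²` for all `x` and `u`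
(`IsMinimal.exists_storage_of_circle_condition`).

By the Kalman–Yakubovich–Popov lemma (`exists_storage_matrix`) such a `P` exists once
`Re ((1 + K₁ G)^* (1 + K₂ G)) > 0` along the Nyquist curve, and this is what each of the three
positions of the plot relative to the disc means (`circle_condition`). The lemma is proved by
duality, without controllability or stability: a certificate of infeasibility is a matrix `Z ≥ 0`,
which splits into rank-one terms, each a frequency response of the system.

For the inertia of `P`, consider the constant gain `K₁`, for which `(u + K₁ y)(u + K₂ y) = 0`: its
closed-loop matrix, shifted by `l`, forms a Lyapunov pair with `P`, so `P` has as many negative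
eigenvalues as that matrix has eigenvalues in the right half plane (`inertia_eq_of_lyapunov`). The
characteristic polynomial of the closed loop is `det (s I - A)` times a multiple of `1 + K₁ G`,
and following the arguments of both polynomials along the vertical line turns the encirclements of
`-1 / K₁` into the number `p` of these eigenvalues (`IsMinimal.countP_closedLoop`).

Minimality enters through the equality of the poles of `G` and the eigenvalues of `A`
(`IsMinimal.denom_eq_charpoly`), which holds because the reduced fraction of `G` has a companion
realization. The value `G(∞) = D` makes `1 + K D` nonzero of constant sign on `[K₁, K₂]`, so that
the loop equations are solved by a differentiable inverse function (`exists_loop_solution`).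
-/

/-! ### Minimal realizations -/

/-- The matrix determinant lemma for the characteristic polynomial of a rank-one perturbation. -/
theorem charpoly_sub_smul_vecMulVec {R ι : Type*} [CommRing R] [IsDomain R] [Fintype ι]
    [DecidableEq ι] (A : Matrix ι ι R) (b c : ι → R) (k : R) :
    (A - k • Matrix.vecMulVec b c).charpoly = A.charpoly + Polynomial.C k *
      ((Polynomial.C ∘ c) ⬝ᵥ (A.charmatrix.adjugate *ᵥ (Polynomial.C ∘ b))) := by
  let K := FractionRing (Polynomial R)
  let f : Polynomial R →+* K := algebraMap _ _
  have hf : Function.Injective f := IsFractionRing.injective _ _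
  apply hf
  have hdet : IsUnit (A.charmatrix.map f).det := by
    rw [← RingHom.mapMatrix_apply, ← RingHom.map_det]
    exact (map_ne_zero_iff f hf).2 A.charpoly_monic.ne_zero |>.isUnit
  have h1 : (A - k • Matrix.vecMulVec b c).charmatrix.map f = A.charmatrix.map f
      + Matrix.replicateCol Unit (f ∘ (Polynomial.C ∘ (k • b))) *
        Matrix.replicateRow Unit (f ∘ (Polynomial.C ∘ c)) := by
    ext i j
    simp [Matrix.charmatrix, Matrix.mul_apply, Matrix.vecMulVec_apply]
    ring
  have h2 : f (A - k • Matrix.vecMulVec b c).charpoly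
      = ((A - k • Matrix.vecMulVec b c).charmatrix.map f).det := by
    rw [← RingHom.mapMatrix_apply, ← RingHom.map_det]; rfl
  have h3 : f A.charpoly = (A.charmatrix.map f).det := by
    rw [← RingHom.mapMatrix_apply, ← RingHom.map_det]; rfl
  have h4 : (A.charmatrix.map f).adjugate = A.charmatrix.adjugate.map f := by
    rw [← RingHom.mapMatrix_apply, ← RingHom.map_adjugate]; rfl
  rw [h2, h1, Matrix.det_add_replicateCol_mul_replicateRow hdet, map_add, h3]
  have h5 : (1 + Matrix.replicateRow Unit (f ∘ (Polynomial.C ∘ c)) * (A.charmatrix.map f)⁻¹ *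
      Matrix.replicateCol Unit (f ∘ (Polynomial.C ∘ (k • b)))).det
      = 1 + (f ∘ (Polynomial.C ∘ c)) ⬝ᵥ ((A.charmatrix.map f)⁻¹ *ᵥ
        (f ∘ (Polynomial.C ∘ (k • b)))) := by
    rw [Matrix.det_unique, Matrix.mul_assoc]
    simp [Matrix.mul_apply, dotProduct, Matrix.mulVec]
  rw [h5, mul_add, mul_one, Matrix.inv_def, h4]
  have h6 : f ∘ (Polynomial.C ∘ (k • b)) = f (Polynomial.C k) • (f ∘ (Polynomial.C ∘ b)) := by
    ext i; simp
  rw [h6, Matrix.mulVec_smul, Matrix.smul_mulVec, dotProduct_smul, dotProduct_smul, map_mul,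
    smul_eq_mul, smul_eq_mul, Ring.inverse_eq_inv', RingHom.map_dotProduct]
  have h7 : f ∘ (A.charmatrix.adjugate *ᵥ (Polynomial.C ∘ b))
      = A.charmatrix.adjugate.map f *ᵥ (f ∘ (Polynomial.C ∘ b)) := by
    ext i; simp [RingHom.map_mulVec]
  rw [h7]
  have e : ∀ d k x : K, d ≠ 0 → d + d * (k * (d⁻¹ * x)) = d + k * x := fun d k x hd => by
    rw [mul_left_comm, mul_inv_cancel_left₀ hd]
  exact e _ _ _ hdet.ne_zero

namespace SISOSystem

variable {n : ℕ}

/-- The polynomial `C adj(s I - A) B`, the numerator of the strictly proper part of the transfer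
function over the denominator `det (s I - A)`. -/
noncomputable def strictNum (S : SISOSystem n) : Polynomial ℝ :=
  (Polynomial.C ∘ S.C) ⬝ᵥ (S.A.charmatrix.adjugate *ᵥ (Polynomial.C ∘ S.B))

theorem charpoly_feedback (S : SISOSystem n) (k : ℝ) :
    (S.A - k • Matrix.vecMulVec S.B S.C).charpoly
      = S.A.charpoly + Polynomial.C k * S.strictNum :=
  charpoly_sub_smul_vecMulVec _ _ _ _

/-- `C adj(s I - A) B` is the difference of two monic polynomials of degree `n`, the characteristic
polynomials of `A - B C` and of `A`. -/
theorem degree_strictNum_lt (S : SISOSystem n) : S.strictNum.degree < S.A.charpoly.degree := by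
  have h := S.charpoly_feedback 1
  rw [map_one, one_mul] at h
  have h' : S.strictNum = (S.A - (1 : ℝ) • Matrix.vecMulVec S.B S.C).charpoly - S.A.charpoly := by
    rw [h]; ring
  rw [h']
  have hd : (S.A - (1 : ℝ) • Matrix.vecMulVec S.B S.C).charpoly.degree = S.A.charpoly.degree := by
    rw [Polynomial.degree_eq_natDegree (Matrix.charpoly_monic _).ne_zero,
      Polynomial.degree_eq_natDegree (Matrix.charpoly_monic _).ne_zero,
      Matrix.charpoly_natDegree_eq_dim, Matrix.charpoly_natDegree_eq_dim]
  have := Polynomial.degree_sub_lt_left hd (Matrix.charpoly_monic _).ne_zero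
    (by rw [(Matrix.charpoly_monic _).leadingCoeff, (Matrix.charpoly_monic _).leadingCoeff])
  rwa [hd] at this

theorem scalar_sub_map_C (A : Matrix (Fin n) (Fin n) ℝ) :
    Matrix.scalar (Fin n) (RatFunc.X : RatFunc ℝ) - A.map RatFunc.C
      = A.charmatrix.map (algebraMap (Polynomial ℝ) (RatFunc ℝ)) := by
  ext i j
  by_cases h : i = j
  · subst h; simp [Matrix.charmatrix]
  · simp [Matrix.charmatrix, h]

theorem det_charmatrix_map (A : Matrix (Fin n) (Fin n) ℝ) :
    (A.charmatrix.map (algebraMap (Polynomial ℝ) (RatFunc ℝ))).det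
      = algebraMap (Polynomial ℝ) (RatFunc ℝ) A.charpoly := by
  rw [← RingHom.mapMatrix_apply, ← RingHom.map_det]; rfl

theorem transfer_eq (S : SISOSystem n) :
    S.transfer = algebraMap (Polynomial ℝ) (RatFunc ℝ) S.strictNum /
      algebraMap (Polynomial ℝ) (RatFunc ℝ) S.A.charpoly + RatFunc.C S.D := by
  have hdet := det_charmatrix_map S.A
  have h4 : (S.A.charmatrix.map (algebraMap (Polynomial ℝ) (RatFunc ℝ))).adjugate
      = S.A.charmatrix.adjugate.map (algebraMap (Polynomial ℝ) (RatFunc ℝ)) := by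
    rw [← RingHom.mapMatrix_apply, ← RingHom.map_adjugate]; rfl
  have hC : ∀ v : Fin n → ℝ, RatFunc.C ∘ v
      = algebraMap (Polynomial ℝ) (RatFunc ℝ) ∘ (Polynomial.C ∘ v) := by
    intro v; ext i; simp
  unfold transfer
  rw [scalar_sub_map_C, Matrix.inv_def, h4, hdet, Matrix.smul_mulVec, dotProduct_smul,
    Ring.inverse_eq_inv', hC, hC, strictNum, RingHom.map_dotProduct]
  have h7 : algebraMap (Polynomial ℝ) (RatFunc ℝ) ∘
      (S.A.charmatrix.adjugate *ᵥ (Polynomial.C ∘ S.B))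
      = S.A.charmatrix.adjugate.map (algebraMap (Polynomial ℝ) (RatFunc ℝ)) *ᵥ
        (algebraMap (Polynomial ℝ) (RatFunc ℝ) ∘ (Polynomial.C ∘ S.B)) := by
    ext i; simp [RingHom.map_mulVec]
  rw [h7, smul_eq_mul, div_eq_inv_mul]

/-- The controllable companion form: every strictly proper fraction `N / d` with `d` monic, plus a
constant, has a realization of dimension `deg d`. -/
theorem exists_realization (N d : Polynomial ℝ) (hd : d.Monic) (hN : N.degree < d.degree) (D : ℝ) :
    ∃ T : SISOSystem d.natDegree, T.transfer = algebraMap (Polynomial ℝ) (RatFunc ℝ) N /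
      algebraMap (Polynomial ℝ) (RatFunc ℝ) d + RatFunc.C D := by
  set m := d.natDegree with hm
  let A : Matrix (Fin m) (Fin m) ℝ := fun i j =>
    if (i : ℕ) + 1 = m then -d.coeff j else if (j : ℕ) = i + 1 then 1 else 0
  let b : Fin m → ℝ := fun i => if (i : ℕ) + 1 = m then 1 else 0
  let c : Fin m → ℝ := fun i => N.coeff i
  refine ⟨⟨A, b, c, D⟩, ?_⟩
  have hd0 : algebraMap (Polynomial ℝ) (RatFunc ℝ) d ≠ 0 := RatFunc.algebraMap_ne_zero hd.ne_zero
  have hA : ∀ i j, A.map RatFunc.C i j = RatFunc.C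
      (if (i : ℕ) + 1 = m then -d.coeff j else if (j : ℕ) = i + 1 then 1 else 0) := fun _ _ => rfl
  -- `v = (1, s, …, s^(m-1))` solves `(s I - A) v = d(s) b`
  let v : Fin m → RatFunc ℝ := fun i => RatFunc.X ^ (i : ℕ)
  have key : (Matrix.scalar (Fin m) (RatFunc.X : RatFunc ℝ) - A.map RatFunc.C) *ᵥ v
      = algebraMap (Polynomial ℝ) (RatFunc ℝ) d • (RatFunc.C ∘ b) := by
    ext i
    rw [Matrix.sub_mulVec, Pi.sub_apply, Matrix.scalar_apply, Matrix.mulVec_diagonal]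
    by_cases hi : (i : ℕ) + 1 = m
    · have h1 : (A.map RatFunc.C *ᵥ v) i
          = -∑ j : Fin m, RatFunc.C (d.coeff j) * RatFunc.X ^ (j : ℕ) := by
        simp [Matrix.mulVec, dotProduct, hA, hi, v, -Matrix.map_apply]
      have h2 : algebraMap (Polynomial ℝ) (RatFunc ℝ) d
          = ∑ j ∈ Finset.range (m + 1), RatFunc.C (d.coeff j) * RatFunc.X ^ j := by
        conv_lhs => rw [d.as_sum_range_C_mul_X_pow]
        simp [hm]
      rw [h1, Fin.sum_univ_eq_sum_range (fun j => RatFunc.C (d.coeff j) * RatFunc.X ^ j) m]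
      simp only [Pi.smul_apply, Function.comp, b, hi, if_true, map_one, smul_eq_mul, mul_one, v]
      have h3 : d.coeff m = 1 := hd.coeff_natDegree
      rw [h2, Finset.sum_range_succ, h3, map_one, one_mul, ← pow_succ', sub_neg_eq_add, add_comm]
      congr 2
    · have hi' : (i : ℕ) + 1 < m := by omega
      have h1 : (A.map RatFunc.C *ᵥ v) i = RatFunc.X ^ ((i : ℕ) + 1) := by
        rw [Matrix.mulVec, dotProduct, Finset.sum_eq_single ⟨(i : ℕ) + 1, hi'⟩]
        · simp [hA, hi, v, -Matrix.map_apply]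
        · intro j _ hj
          have : (j : ℕ) ≠ i + 1 := fun h => hj (Fin.ext h)
          simp [hA, hi, this, -Matrix.map_apply]
        · simp
      simp only [Pi.smul_apply, Function.comp, b, hi, h1, v, if_false, map_zero, smul_zero]
      ring
  have hdet : IsUnit (Matrix.scalar (Fin m) (RatFunc.X : RatFunc ℝ) - A.map RatFunc.C).det := by
    rw [scalar_sub_map_C, det_charmatrix_map]
    exact (RatFunc.algebraMap_ne_zero A.charpoly_monic.ne_zero).isUnit
  have hsol : (Matrix.scalar (Fin m) (RatFunc.X : RatFunc ℝ) - A.map RatFunc.C)⁻¹ *ᵥ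
      (RatFunc.C ∘ b) = (algebraMap (Polynomial ℝ) (RatFunc ℝ) d)⁻¹ • v := by
    have : RatFunc.C ∘ b = (algebraMap (Polynomial ℝ) (RatFunc ℝ) d)⁻¹ •
        ((Matrix.scalar (Fin m) (RatFunc.X : RatFunc ℝ) - A.map RatFunc.C) *ᵥ v) := by
      rw [key, smul_smul, inv_mul_cancel₀ hd0, one_smul]
    rw [this, Matrix.mulVec_smul, Matrix.mulVec_mulVec, Matrix.nonsing_inv_mul _ hdet,
      Matrix.one_mulVec]
  have hNsum : algebraMap (Polynomial ℝ) (RatFunc ℝ) N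
      = (RatFunc.C ∘ c) ⬝ᵥ v := by
    have hlt : N.natDegree < m ∨ N = 0 := by
      by_cases h0 : N = 0
      · exact Or.inr h0
      · exact Or.inl (Polynomial.natDegree_lt_natDegree h0 hN)
    rcases hlt with hlt | rfl
    · conv_lhs => rw [N.as_sum_range_C_mul_X_pow' hlt]
      simp only [dotProduct, Function.comp, c, v]
      rw [Fin.sum_univ_eq_sum_range (fun j => RatFunc.C (N.coeff j) * RatFunc.X ^ j) m]
      simp
    · simp [dotProduct, c]
  unfold transfer
  simp only
  rw [hsol, dotProduct_smul, ← hNsum, smul_eq_mul, div_eq_inv_mul]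

/-- For a minimal realization the poles of the transfer function are the eigenvalues of `A`, with
multiplicity: otherwise the companion form of the reduced fraction would be smaller. -/
theorem IsMinimal.denom_eq_charpoly {S : SISOSystem n} (h : S.IsMinimal) :
    S.transfer.denom = S.A.charpoly := by
  set g : RatFunc ℝ := algebraMap (Polynomial ℝ) (RatFunc ℝ) S.strictNum /
      algebraMap (Polynomial ℝ) (RatFunc ℝ) S.A.charpoly with hg
  have ha := S.A.charpoly_monic
  have hdvd : g.denom ∣ S.A.charpoly := RatFunc.denom_div_dvd _ _
  have hdeg : g.num.degree < g.denom.degree := by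
    have h1 : g.num * S.A.charpoly = S.strictNum * g.denom :=
      (RatFunc.num_mul_eq_mul_denom_iff ha.ne_zero).2 hg
    by_contra hcon
    push Not at hcon
    have h2 := congrArg Polynomial.degree h1
    rw [Polynomial.degree_mul, Polynomial.degree_mul] at h2
    have h3 := S.degree_strictNum_lt
    have h4 : S.strictNum.degree + g.denom.degree < S.A.charpoly.degree + g.denom.degree := by
      rw [Polynomial.degree_eq_natDegree g.denom_ne_zero]
      exact WithBot.add_lt_add_right (WithBot.coe_ne_bot) h3
    have h5 : S.A.charpoly.degree + g.denom.degree ≤ g.num.degree + S.A.charpoly.degree := by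
      rw [add_comm]; exact add_le_add hcon le_rfl
    exact absurd (h4.trans_le h5) (by rw [h2]; exact lt_irrefl _)
  obtain ⟨T, hT⟩ := exists_realization g.num g.denom g.monic_denom hdeg S.D
  have hn := h _ T (by rw [hT, RatFunc.num_div_denom, hg, ← S.transfer_eq])
  have hgd : g.denom = S.A.charpoly := by
    refine (Polynomial.eq_of_monic_of_dvd_of_natDegree_le g.monic_denom ha hdvd ?_).symm
    rw [Matrix.charpoly_natDegree_eq_dim, Fintype.card_fin]; exact hn
  have hSg : S.transfer = g + RatFunc.C S.D := S.transfer_eq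
  apply Polynomial.eq_of_monic_of_associated S.transfer.monic_denom ha
  apply associated_of_dvd_dvd
  · have := RatFunc.denom_add_dvd g (RatFunc.C S.D)
    rwa [← hSg, RatFunc.denom_C, mul_one, hgd] at this
  · have := RatFunc.denom_add_dvd S.transfer (RatFunc.C (-S.D))
    rw [RatFunc.denom_C, mul_one, hSg, map_neg, add_neg_cancel_right, hgd] at this
    rwa [hSg]

end SISOSystem

/-! ### The Kalman–Yakubovich–Popov lemma -/

section

open scoped InnerProductSpace

/-- If `F G† + G F† = 0`, the source has an orthonormal basis each of whose vectors is killed by `G`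
or mapped by `F` to an imaginary multiple of its image under `G`. On the range of `G†` such vectors
are the eigenvectors of a skew-adjoint operator; the orthogonal complement is the kernel of `G`. -/
theorem exists_orthonormalBasis_imaginary_multiple {E Y : Type*}
    [NormedAddCommGroup E] [InnerProductSpace ℂ E] [FiniteDimensional ℂ E]
    [NormedAddCommGroup Y] [InnerProductSpace ℂ Y] [FiniteDimensional ℂ Y]
    (F G : E →ₗ[ℂ] Y)
    (h : ∀ x y : Y, ⟪F.adjoint x, G.adjoint y⟫_ℂ + ⟪G.adjoint x, F.adjoint y⟫_ℂ = 0) :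
    ∃ (u : Finset E) (b : OrthonormalBasis u ℂ E), ∀ i, G (b i) = 0 ∨
      ∃ ω : ℝ, F (b i) = ((ω : ℂ) * Complex.I) • G (b i) := by
  set S := LinearMap.range G.adjoint with hS
  obtain ⟨σ, hσ⟩ := G.adjoint.rangeRestrict.exists_rightInverse_of_surjective
    (LinearMap.range_rangeRestrict _)
  have hσ' : ∀ s : S, G.adjoint (σ s) = (s : E) := fun s => by
    have := congrArg (Subtype.val) (LinearMap.congr_fun hσ s)
    simpa using this
  -- `F† (G†)⁻¹` compressed to the range of `G†`; the factor `i` makes it symmetric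
  let T : S →ₗ[ℂ] S := Complex.I • (S.orthogonalProjectionOnto.toLinearMap ∘ₗ F.adjoint ∘ₗ σ)
  have hTin : ∀ (x : E) (hx : x ∈ S) (s : S),
      ⟪x, (T s : E)⟫_ℂ = Complex.I * ⟪x, F.adjoint (σ s)⟫_ℂ := by
    intro x hx s
    have h1 := S.inner_orthogonalProjectionOnto_eq_of_mem_left ⟨x, hx⟩ (F.adjoint (σ s))
    simp only [Submodule.coe_inner] at h1
    simp only [T, LinearMap.smul_apply, LinearMap.comp_apply, Submodule.coe_smul, inner_smul_right]
    rw [← h1]; rfl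
  have hT : T.IsSymmetric := by
    intro s t
    rw [Submodule.coe_inner, Submodule.coe_inner, hTin _ s.2, ← inner_conj_symm, hTin _ t.2, map_mul,
      inner_conj_symm, Complex.conj_I]
    have h1 := h (σ s) (σ t)
    rw [hσ', hσ'] at h1
    linear_combination -Complex.I * h1
  let e := hT.eigenvectorBasis rfl
  have hon : Orthonormal ℂ (fun i => (e i : E)) :=
    e.orthonormal.comp_linearIsometry S.subtypeₗᵢ
  obtain ⟨u, b, hu, hb⟩ := hon.toSubtypeRange.exists_orthonormalBasis_extension
  refine ⟨u, b, fun i => ?_⟩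
  have hbi : b i = (i : E) := by rw [hb]
  by_cases hi : (i : E) ∈ Set.range (fun i => (e i : E))
  · obtain ⟨k, hk⟩ := hi
    refine Or.inr ⟨hT.eigenvalues rfl k, ?_⟩
    refine ext_inner_left ℂ fun y => ?_
    have h1 := h y (σ (e k))
    have h2 : T (e k) = ((hT.eigenvalues rfl k : ℝ) : ℂ) • e k := hT.apply_eigenvectorBasis rfl k
    have h3 := hTin (G.adjoint y) ⟨y, rfl⟩ (e k)
    rw [h2, Submodule.coe_smul, inner_smul_right] at h3
    rw [hσ'] at h1
    rw [hbi, ← hk, inner_smul_right, ← LinearMap.adjoint_inner_left, ← LinearMap.adjoint_inner_left]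
    simp only at h1 h3 ⊢
    linear_combination h1 - Complex.I * h3 - ⟪G.adjoint y, F.adjoint (σ (e k))⟫_ℂ * Complex.I_mul_I
  · refine Or.inl (ext_inner_left ℂ fun y => ?_)
    rw [inner_zero_right, ← LinearMap.adjoint_inner_left]
    have hperp : ∀ s : S, ⟪(s : E), b i⟫_ℂ = 0 := by
      intro s
      rw [← e.sum_repr s, Submodule.coe_sum, sum_inner]
      refine Finset.sum_eq_zero fun k _ => ?_
      rw [Submodule.coe_smul, inner_smul_left]
      have hk : (e k : E) ∈ u := hu ⟨k, rfl⟩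
      have h1 : (e k : E) = b ⟨e k, hk⟩ := by rw [hb]
      have h2 : (⟨e k, hk⟩ : u) ≠ i := fun h' => hi ⟨k, by rw [← h']⟩
      rw [h1, b.orthonormal.2 h2, mul_zero]
    exact hperp ⟨G.adjoint y, ⟨y, rfl⟩⟩

end

section

variable {ι κ : Type*} [Fintype ι] [Fintype κ] [DecidableEq ι] [DecidableEq κ]

theorem map_ofReal_mul {α β γ : Type*} [Fintype β] (X : Matrix α β ℝ) (Y : Matrix β γ ℝ) :
    (X * Y).map Complex.ofReal = X.map Complex.ofReal * Y.map Complex.ofReal :=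
  Matrix.map_mul (f := Complex.ofRealHom)

/-- A dual certificate `Z = R Rᵀ` splits into rank-one terms satisfying the frequency-domain
relation, on each of which the quadratic form is negative. -/
theorem trace_neg_of_frequency_condition (F G : Matrix κ ι ℝ) (M R : Matrix ι ι ℝ) (hR : R ≠ 0)
    (hFG : G * (R * Rᵀ) * Fᵀ + F * (R * Rᵀ) * Gᵀ = 0)
    (hfreq : ∀ z : ι → ℂ, z ≠ 0 → (G.map Complex.ofReal *ᵥ z = 0 ∨
      ∃ ω : ℝ, F.map Complex.ofReal *ᵥ z = ((ω : ℂ) * Complex.I) • (G.map Complex.ofReal *ᵥ z)) →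
      (star z ⬝ᵥ (M.map Complex.ofReal *ᵥ z)).re < 0) :
    (Rᵀ * M * R).trace < 0 := by
  let L : Matrix κ ι ℝ → EuclideanSpace ℂ ι →ₗ[ℂ] EuclideanSpace ℂ κ :=
    fun X => Matrix.toEuclideanLin ((X * R).map Complex.ofReal)
  have hadj : ∀ X, (L X).adjoint = Matrix.toEuclideanLin ((X * R)ᵀ.map Complex.ofReal) := by
    intro X
    rw [← Matrix.toEuclideanLin_conjTranspose_eq_adjoint]
    congr 1
    ext i j
    simp [Matrix.conjTranspose_apply, -Matrix.transpose_mul]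
  have hL : ∀ X (v : EuclideanSpace ℂ ι), WithLp.ofLp (L X v)
      = X.map Complex.ofReal *ᵥ (R.map Complex.ofReal *ᵥ WithLp.ofLp v) := by
    intro X v
    rw [Matrix.toLpLin_apply, map_ofReal_mul, Matrix.mulVec_mulVec]
  obtain ⟨u, b, hb⟩ := exists_orthonormalBasis_imaginary_multiple (L F) (L G) (by
    intro x y
    have h1 : ∀ X Y : Matrix κ ι ℝ, inner ℂ ((L X).adjoint x) ((L Y).adjoint y)
        = inner ℂ x (Matrix.toEuclideanLin ((X * (R * Rᵀ) * Yᵀ).map Complex.ofReal) y) := by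
      intro X Y
      rw [LinearMap.adjoint_inner_left, hadj]
      congr 1
      apply (WithLp.ofLp_injective 2)
      rw [hL, Matrix.toLpLin_apply, Matrix.toLpLin_apply, Matrix.transpose_mul]
      simp only [map_ofReal_mul, Matrix.mulVec_mulVec, Matrix.mul_assoc]
    rw [h1, h1, ← inner_add_right, ← LinearMap.add_apply, ← map_add,
      show ∀ P Q : Matrix κ κ ℝ, P.map Complex.ofReal + Q.map Complex.ofReal
        = (P + Q).map Complex.ofReal from fun P Q => by ext; simp, add_comm, hFG]
    simp [Matrix.map_zero])
  let w : u → ι → ℂ := fun i => R.map Complex.ofReal *ᵥ WithLp.ofLp (b i)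
  have htr : (((Rᵀ * M * R).trace : ℝ) : ℂ) = ∑ i, star (w i) ⬝ᵥ (M.map Complex.ofReal *ᵥ w i) := by
    have h1 : (((Rᵀ * M * R).trace : ℝ) : ℂ) = LinearMap.trace ℂ _
        (Matrix.toEuclideanLin ((Rᵀ * M * R).map Complex.ofReal)) := by
      have h2 := LinearMap.congr_fun (congrArg LinearEquiv.toLinearMap
        (Matrix.toLpLin_eq_toLin (R := ℂ) (m := ι) (n := ι) 2 2))
        ((Rᵀ * M * R).map Complex.ofReal)
      simp only [LinearEquiv.coe_coe] at h2
      rw [h2, Matrix.trace_toLin_eq]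
      simp only [Matrix.trace, Matrix.diag_apply, Matrix.map_apply, Complex.ofReal_sum]
    rw [h1, LinearMap.trace_eq_sum_inner _ b]
    refine Finset.sum_congr rfl fun i _ => ?_
    rw [EuclideanSpace.inner_eq_star_dotProduct, Matrix.toLpLin_apply, dotProduct_comm]
    simp only [w, map_ofReal_mul]
    rw [Matrix.star_mulVec, ← Matrix.dotProduct_mulVec]
    congr 1
    rw [Matrix.mulVec_mulVec, Matrix.mulVec_mulVec]
    congr 3
    ext i j
    simp [Matrix.conjTranspose_apply]
  have hneg : ∀ i, w i ≠ 0 → (star (w i) ⬝ᵥ (M.map Complex.ofReal *ᵥ w i)).re < 0 := by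
    intro i hi
    refine hfreq _ hi ?_
    rcases hb i with h0 | ⟨ω, h0⟩
    · left
      rw [← hL, h0]; rfl
    · right
      refine ⟨ω, ?_⟩
      rw [← hL, ← hL, h0]; rfl
  have hex : ∃ i, w i ≠ 0 := by
    by_contra hcon
    push Not at hcon
    apply hR
    have h0 : Matrix.toEuclideanLin (R.map Complex.ofReal) = 0 := by
      refine b.toBasis.ext fun i => ?_
      rw [b.coe_toBasis]
      apply (WithLp.ofLp_injective 2)
      rw [Matrix.toLpLin_apply]
      exact hcon i
    have h1 : R.map Complex.ofReal = 0 := by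
      rwa [LinearEquiv.map_eq_zero_iff] at h0
    ext i j
    have := congrFun (congrFun h1 i) j
    simpa using this
  have hre := congrArg Complex.re htr
  rw [Complex.ofReal_re, Complex.re_sum] at hre
  rw [hre]
  obtain ⟨i, hi⟩ := hex
  refine Finset.sum_neg' (fun j _ => ?_) ⟨i, Finset.mem_univ _, hneg i hi⟩
  by_cases hj : w j = 0
  · simp [hj]
  · exact (hneg j hj).le

/-- The positive semidefinite matrices of trace one are the Gram matrices `R Rᵀ` of the square
matrices of Frobenius norm one. -/
theorem posSemidef_trace_one_iff (Z : Matrix ι ι ℝ) :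
    Z.PosSemidef ∧ Z.trace = 1 ↔ ∃ R : Matrix ι ι ℝ, ∑ i, ∑ j, R i j ^ 2 = 1 ∧ Z = R * Rᵀ := by
  have htr : ∀ R : Matrix ι ι ℝ, (R * Rᵀ).trace = ∑ i, ∑ j, R i j ^ 2 := by
    intro R
    simp [Matrix.trace, Matrix.mul_apply, sq]
  constructor
  · rintro ⟨hZ, h1⟩
    open scoped MatrixOrder in
    have hs := CFC.sqrt_mul_sqrt_self Z hZ.nonneg
    open scoped MatrixOrder in
    have hsym : (CFC.sqrt Z)ᵀ = CFC.sqrt Z := by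
      have := (Matrix.nonneg_iff_posSemidef.1 (CFC.sqrt_nonneg Z)).isHermitian
      rwa [Matrix.IsHermitian, Matrix.conjTranspose_eq_transpose_of_trivial] at this
    refine ⟨CFC.sqrt Z, ?_, ?_⟩
    · rw [← htr, hsym, hs, h1]
    · rw [hsym, hs]
  · rintro ⟨R, hR, rfl⟩
    refine ⟨?_, by rw [htr, hR]⟩
    have := Matrix.posSemidef_self_mul_conjTranspose R
    rwa [Matrix.conjTranspose_eq_transpose_of_trivial] at this

/-- The Kalman–Yakubovich–Popov lemma: the strict frequency-domain inequality for the form `M` along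
the complex solutions of `F z = i ω G z` (with `ω = ∞` read as `G z = 0`) gives a symmetric
storage matrix `P`. The pairs `(tr (M Z), G Z Fᵀ + F Z Gᵀ)`, for `Z ≥ 0` of trace one, form a compact
convex set that misses the ray `[0, ∞) × {0}`, and `P` is read off from a separating functional. -/
theorem exists_storage_matrix (F G : Matrix κ ι ℝ) (M : Matrix ι ι ℝ)
    (hfreq : ∀ z : ι → ℂ, z ≠ 0 → (G.map Complex.ofReal *ᵥ z = 0 ∨
      ∃ ω : ℝ, F.map Complex.ofReal *ᵥ z = ((ω : ℂ) * Complex.I) • (G.map Complex.ofReal *ᵥ z)) →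
      (star z ⬝ᵥ (M.map Complex.ofReal *ᵥ z)).re < 0) :
    ∃ (P : Matrix κ κ ℝ) (ε : ℝ), P.IsSymm ∧ 0 < ε ∧ ∀ z : ι → ℝ,
      z ⬝ᵥ (M *ᵥ z) + 2 * ((G *ᵥ z) ⬝ᵥ (P *ᵥ (F *ᵥ z))) ≤ -ε * (z ⬝ᵥ z) := by
  let Φ : Matrix ι ι ℝ →ₗ[ℝ] ℝ × (κ → κ → ℝ) :=
    { toFun := fun Z => ((M * Z).trace, G * Z * Fᵀ + F * Z * Gᵀ)
      map_add' := fun X Y => by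
        refine Prod.ext ?_ ?_
        · simp [Matrix.mul_add]
        · simp only [Matrix.mul_add, Matrix.add_mul, Prod.snd_add]
          exact add_add_add_comm _ _ _ _
      map_smul' := fun c X => by
        refine Prod.ext ?_ ?_
        · simp
        · simp only [Matrix.mul_smul, Matrix.smul_mul, RingHom.id_apply, Prod.smul_snd]
          exact (smul_add _ _ _).symm }
  let T : Set (Matrix ι ι ℝ) := {Z | Z.PosSemidef ∧ Z.trace = 1}
  have hTconv : Convex ℝ T := by
    rintro X ⟨hX, hX1⟩ Y ⟨hY, hY1⟩ a b ha hb hab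
    refine ⟨(hX.smul ha).add (hY.smul hb), ?_⟩
    rw [Matrix.trace_add, Matrix.trace_smul, Matrix.trace_smul, hX1, hY1]
    simpa using hab
  have hKcomp : IsCompact (Φ '' T) := by
    let Sph : Set (ι → ι → ℝ) := {R | ∑ i, ∑ j, R i j ^ 2 = 1}
    have hSph : IsCompact Sph := by
      apply Metric.isCompact_of_isClosed_isBounded
      · exact isClosed_eq (by fun_prop) continuous_const
      · refine (Metric.isBounded_closedBall (x := (0 : ι → ι → ℝ)) (r := 1)).subset fun R hR => ?_
        rw [mem_closedBall_zero_iff, pi_norm_le_iff_of_nonneg zero_le_one]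
        intro i
        rw [pi_norm_le_iff_of_nonneg zero_le_one]
        intro j
        have h1 : R i j ^ 2 ≤ 1 := by
          rw [← show ∑ i, ∑ j, R i j ^ 2 = 1 from hR]
          exact (Finset.single_le_sum (f := fun j => R i j ^ 2) (fun _ _ => sq_nonneg _)
            (Finset.mem_univ j)).trans (Finset.single_le_sum (f := fun i => ∑ j, R i j ^ 2)
            (fun _ _ => Finset.sum_nonneg fun _ _ => sq_nonneg _) (Finset.mem_univ i))
        rw [Real.norm_eq_abs]
        exact (sq_le_one_iff_abs_le_one _).1 h1
    have himg : Φ '' T = (fun R : ι → ι → ℝ => Φ (Matrix.of R * (Matrix.of R)ᵀ)) '' Sph := by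
      ext v
      constructor
      · rintro ⟨Z, hZ, rfl⟩
        obtain ⟨R, hR, rfl⟩ := (posSemidef_trace_one_iff Z).1 hZ
        exact ⟨R, hR, rfl⟩
      · rintro ⟨R, hR, rfl⟩
        exact ⟨_, (posSemidef_trace_one_iff _).2 ⟨Matrix.of R, hR, rfl⟩, rfl⟩
    rw [himg]
    refine hSph.image ?_
    have hc : Continuous fun R : ι → ι → ℝ => Matrix.of R * (Matrix.of R)ᵀ := by
      have h1 : Continuous fun R : ι → ι → ℝ => (Matrix.of R : Matrix ι ι ℝ) := continuous_id
      exact h1.matrix_mul h1.matrix_transpose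
    have hΦ : Continuous fun Z : Matrix ι ι ℝ =>
        (((M * Z).trace, G * Z * Fᵀ + F * Z * Gᵀ) : ℝ × Matrix κ κ ℝ) := by fun_prop
    exact hΦ.comp hc
  let t : Set (ℝ × (κ → κ → ℝ)) := {v | 0 ≤ v.1 ∧ v.2 = 0}
  have htconv : Convex ℝ t := by
    rintro x ⟨hx, hx'⟩ y ⟨hy, hy'⟩ a b ha hb hab
    refine ⟨?_, ?_⟩
    · simp only [Prod.fst_add, Prod.smul_fst, smul_eq_mul]; positivity
    · simp [hx', hy']
  have htclosed : IsClosed t :=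
    (isClosed_le continuous_const continuous_fst).inter
      (isClosed_eq continuous_snd continuous_const)
  have hdisj : Disjoint (Φ '' T) t := by
    rw [Set.disjoint_left]
    rintro _ ⟨Z, hZ, rfl⟩ ⟨h1, h2⟩
    obtain ⟨R, hR, rfl⟩ := (posSemidef_trace_one_iff Z).1 hZ
    have hR0 : R ≠ 0 := by rintro rfl; simp at hR
    have h3 := trace_neg_of_frequency_condition F G M R hR0 h2 hfreq
    have h4 : (M * (R * Rᵀ)).trace = (Rᵀ * M * R).trace := by
      rw [← Matrix.mul_assoc, Matrix.trace_mul_comm, Matrix.mul_assoc]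
    have h5 : 0 ≤ (M * (R * Rᵀ)).trace := h1
    linarith
  obtain ⟨f, u, v, hfu, huv, hfv⟩ := geometric_hahn_banach_compact_closed
    (hTconv.is_linear_image Φ.isLinear) hKcomp htconv htclosed hdisj
  have hv : v < 0 := by
    have := hfv 0 ⟨le_rfl, rfl⟩
    rwa [map_zero] at this
  have hu : u < 0 := huv.trans hv
  set c : ℝ := f (1, 0) with hc
  have hfc : ∀ s : ℝ, f (s, 0) = s * c := by
    intro s
    have : ((s, 0) : ℝ × (κ → κ → ℝ)) = s • (1, 0) := by simp
    rw [this, map_smul, smul_eq_mul]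
  have hc0 : 0 ≤ c := by
    by_contra hneg
    push Not at hneg
    have := hfv (v / c, 0) ⟨(div_pos_of_neg_of_neg hv hneg).le, rfl⟩
    rw [hfc, div_mul_cancel₀ _ hneg.ne] at this
    exact lt_irrefl _ this
  let Q : Matrix κ κ ℝ := Matrix.of fun i j => f (0, Pi.single i (Pi.single j 1))
  have hfQ : ∀ S : κ → κ → ℝ, f (0, S) = ∑ i, ∑ j, S i j * Q i j := by
    intro S
    have hS : ((0, S) : ℝ × (κ → κ → ℝ))
        = ∑ i, ∑ j, S i j • (0, Pi.single i (Pi.single j 1)) := by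
      refine Prod.ext (by simp [Prod.fst_sum]) ?_
      funext a b
      simp [Prod.snd_sum, Finset.sum_apply, Pi.single_apply, ite_apply]
    rw [hS, map_sum]
    refine Finset.sum_congr rfl fun i _ => ?_
    rw [map_sum]
    refine Finset.sum_congr rfl fun j _ => ?_
    rw [map_smul, smul_eq_mul]
    rfl
  -- the quadratic form is bounded by `β` on the unit sphere
  set β : ℝ := ∑ i, ∑ j, |M i j| + 1 with hβ
  have hβ0 : 0 < β := by positivity
  have hquad : ∀ z : ι → ℝ, z ⬝ᵥ z = 1 → z ⬝ᵥ (M *ᵥ z) ≤ β := by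
    intro z hz
    have hz1 : ∀ i, |z i| ≤ 1 := by
      intro i
      rw [← sq_le_one_iff_abs_le_one, ← hz, sq]
      exact Finset.single_le_sum (f := fun i => z i * z i) (fun _ _ => mul_self_nonneg _)
        (Finset.mem_univ i)
    have : z ⬝ᵥ (M *ᵥ z) ≤ ∑ i, ∑ j, |M i j| := by
      simp only [dotProduct, Matrix.mulVec, Finset.mul_sum]
      refine Finset.sum_le_sum fun i _ => Finset.sum_le_sum fun j _ => ?_
      calc z i * (M i j * z j) ≤ |z i * (M i j * z j)| := le_abs_self _
        _ = |z i| * (|M i j| * |z j|) := by rw [abs_mul, abs_mul]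
        _ ≤ 1 * (|M i j| * 1) := by gcongr <;> exact hz1 _
        _ = |M i j| := by ring
    linarith
  -- the coefficient `c` may vanish; a small multiple of the strict gap makes it positive
  set δ : ℝ := -u / (2 * β) with hδ
  have hδ0 : 0 < δ := by
    apply div_pos <;> linarith
  have hcδ : 0 < c + δ := by linarith
  refine ⟨(2 * (c + δ))⁻¹ • (Q + Qᵀ), -u / (2 * (c + δ)), ?_, by
    apply div_pos <;> linarith, ?_⟩
  · rw [Matrix.IsSymm, Matrix.transpose_smul, Matrix.transpose_add, Matrix.transpose_transpose,
      add_comm Q]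
  have hunit : ∀ z : ι → ℝ, z ⬝ᵥ z = 1 → z ⬝ᵥ (M *ᵥ z) + 2 * ((G *ᵥ z) ⬝ᵥ
      (((2 * (c + δ))⁻¹ • (Q + Qᵀ)) *ᵥ (F *ᵥ z))) ≤ -(-u / (2 * (c + δ))) := by
    intro z hz
    have hmem : Matrix.vecMulVec z z ∈ T := by
      refine ⟨by simpa using Matrix.posSemidef_vecMulVec_self_star z, ?_⟩
      rw [← hz]; simp [Matrix.trace, Matrix.vecMulVec_apply, dotProduct]
    have h1 := hfu _ ⟨_, hmem, rfl⟩
    have h2 : Φ (Matrix.vecMulVec z z) = (z ⬝ᵥ (M *ᵥ z), 0)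
        + (0, fun i j => (G *ᵥ z) i * (F *ᵥ z) j + (F *ᵥ z) i * (G *ᵥ z) j) := by
      refine Prod.ext ?_ ?_
      · simp [Φ, Matrix.mul_vecMulVec, Matrix.trace_vecMulVec, dotProduct_comm]
      · funext i j
        simp [Φ, Matrix.mul_vecMulVec, Matrix.vecMulVec_mul, Matrix.vecMulVec_apply,
          Matrix.vecMul_transpose]
    rw [h2, map_add, hfc, hfQ] at h1
    have h3 : ∑ i, ∑ j, ((G *ᵥ z) i * (F *ᵥ z) j + (F *ᵥ z) i * (G *ᵥ z) j) * Q i j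
        = (G *ᵥ z) ⬝ᵥ ((Q + Qᵀ) *ᵥ (F *ᵥ z)) := by
      generalize G *ᵥ z = a
      generalize F *ᵥ z = b
      simp only [add_mul, Finset.sum_add_distrib, Matrix.add_mulVec, dotProduct_add]
      congr 1
      · simp only [dotProduct, Matrix.mulVec, Finset.mul_sum]
        refine Finset.sum_congr rfl fun i _ => Finset.sum_congr rfl fun j _ => by ring
      · rw [Finset.sum_comm]
        simp only [dotProduct, Matrix.mulVec, Finset.mul_sum, Matrix.transpose_apply]
        refine Finset.sum_congr rfl fun i _ => Finset.sum_congr rfl fun j _ => by ring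
    rw [h3] at h1
    rw [Matrix.smul_mulVec, dotProduct_smul, smul_eq_mul]
    set q := z ⬝ᵥ (M *ᵥ z)
    set g := (G *ᵥ z) ⬝ᵥ ((Q + Qᵀ) *ᵥ (F *ᵥ z))
    have h4 : δ * q ≤ -u / 2 := by
      calc δ * q ≤ δ * β := by gcongr; exact hquad z hz
        _ = -u / 2 := by rw [hδ]; field_simp
    have h5 : q * (c + δ) + g ≤ u / 2 := by nlinarith
    have h6 : q + 2 * ((2 * (c + δ))⁻¹ * g) = (q * (c + δ) + g) / (c + δ) := by
      field_simp
    rw [h6, div_le_iff₀ hcδ]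
    have h7 : -(-u / (2 * (c + δ))) * (c + δ) = u / 2 := by field_simp
    rw [h7]; exact h5
  intro z
  by_cases hz : z = 0
  · simp [hz]
  have hzz : 0 < z ⬝ᵥ z := by
    rw [← show star z = z from star_trivial z]
    exact Matrix.dotProduct_star_self_pos_iff.2 hz
  set r := Real.sqrt (z ⬝ᵥ z)
  have hr : r * r = z ⬝ᵥ z := Real.mul_self_sqrt hzz.le
  have hr0 : r ≠ 0 := (Real.sqrt_pos.2 hzz).ne'
  have h1 := hunit (r⁻¹ • z) (by
    rw [smul_dotProduct, dotProduct_smul, ← hr, smul_eq_mul, smul_eq_mul]; field_simp)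
  simp only [Matrix.mulVec_smul, smul_dotProduct, dotProduct_smul, smul_eq_mul] at h1
  have h2 := mul_le_mul_of_nonneg_left h1 (mul_self_nonneg r)
  calc _ = r * r * (r⁻¹ * (r⁻¹ * z ⬝ᵥ (M *ᵥ z)) + 2 * (r⁻¹ * (r⁻¹ * (G *ᵥ z) ⬝ᵥ
      (((2 * (c + δ))⁻¹ • (Q + Qᵀ)) *ᵥ (F *ᵥ z))))) := by field_simp
    _ ≤ _ := h2
    _ = _ := by rw [hr]; ring

end

/-! ### Lyapunov inertia -/

theorem LinearMap.charpoly_eq_mul_of_triangular {K M₁ M₂ : Type*} [Field K]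
    [AddCommGroup M₁] [Module K M₁] [FiniteDimensional K M₁]
    [AddCommGroup M₂] [Module K M₂] [FiniteDimensional K M₂]
    (f : Module.End K (M₁ × M₂)) (hf : ∀ x, (f (x, 0)).2 = 0) :
    f.charpoly = (LinearMap.fst K M₁ M₂ ∘ₗ f ∘ₗ LinearMap.inl K M₁ M₂).charpoly *
      (LinearMap.snd K M₁ M₂ ∘ₗ f ∘ₗ LinearMap.inr K M₁ M₂).charpoly := by
  let b₁ := Module.finBasis K M₁
  let b₂ := Module.finBasis K M₂
  rw [← LinearMap.charpoly_toMatrix f (b₁.prod b₂), ← LinearMap.charpoly_toMatrix _ b₁,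
    ← LinearMap.charpoly_toMatrix _ b₂,
    ← Matrix.charpoly_fromBlocks_zero₂₁ _ (LinearMap.toMatrix b₂ b₁
      (LinearMap.fst K M₁ M₂ ∘ₗ f ∘ₗ LinearMap.inr K M₁ M₂))]
  congr 1
  ext i j
  rcases i with i | i <;> rcases j with j | j <;>
    simp [LinearMap.toMatrix_apply, hf]

section

variable {V : Type} [AddCommGroup V] [Module ℂ V] [FiniteDimensional ℂ V]

/-- A definite subspace of the orthogonal complement of a vector `v` of the same sign extends
by `v`. -/
theorem exists_definite_sup_span (h : V →ₗ⋆[ℂ] V →ₗ[ℂ] ℂ)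
    (hsym : ∀ x y, (starRingEnd ℂ) (h x y) = h y x) (s : ℝ) (v : V) (hv : 0 < s * (h v v).re)
    (N : Submodule ℂ V) (hN : ∀ x ∈ N, x ≠ 0 → 0 < s * (h x x).re) (hperp : ∀ x ∈ N, h v x = 0) :
    ∃ N' : Submodule ℂ V, (∀ x ∈ N', x ≠ 0 → 0 < s * (h x x).re) ∧
      Module.finrank ℂ N' = Module.finrank ℂ N + 1 := by
  have hv0 : v ≠ 0 := by rintro rfl; simp at hv
  refine ⟨(ℂ ∙ v) ⊔ N, ?_, ?_⟩
  · intro x hx hx0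
    obtain ⟨y, hy, w, hw, rfl⟩ := Submodule.mem_sup.1 hx
    obtain ⟨a, rfl⟩ := Submodule.mem_span_singleton.1 hy
    have hvw := hperp w hw
    have hwv : h w v = 0 := by rw [← hsym, hvw, map_zero]
    have h1 : (h (a • v + w) (a • v + w)).re = Complex.normSq a * (h v v).re + (h w w).re := by
      simp only [map_add, LinearMap.add_apply, map_smul, map_smulₛₗ, LinearMap.smul_apply, hvw, hwv,
        smul_eq_mul, add_zero, mul_zero, zero_add, Complex.add_re]
      congr 1
      rw [mul_left_comm, ← mul_assoc, ← Complex.normSq_eq_conj_mul_self]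
      simp
    rw [h1, mul_add]
    by_cases hw0 : w = 0
    · subst hw0
      have ha : a ≠ 0 := by rintro rfl; simp at hx0
      have := mul_pos (Complex.normSq_pos.2 ha) hv
      simp only [map_zero, Complex.zero_re, mul_zero, add_zero]
      linarith
    · have h2 := hN w hw hw0
      have := mul_nonneg (Complex.normSq_nonneg a) hv.le
      linarith
  · have hdisj : (ℂ ∙ v) ⊓ N = ⊥ := by
      rw [Submodule.eq_bot_iff]
      rintro x ⟨hx, hxN⟩
      obtain ⟨a, rfl⟩ := Submodule.mem_span_singleton.1 hx
      have h1 := hperp _ hxN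
      rw [map_smul, smul_eq_mul, mul_eq_zero] at h1
      rcases h1 with rfl | h1
      · simp
      · rw [h1] at hv; simp at hv
    have := Submodule.finrank_sup_add_finrank_inf_eq (ℂ ∙ v) N
    rw [hdisj, finrank_bot, finrank_span_singleton hv0] at this
    omega

end

open scoped Classical in
/-- If `Re h(x, f x) < 0` for all `x ≠ 0`, with `h` a Hermitian form, then no eigenvalue of `f` is
imaginary, `h` is negative definite on a subspace whose dimension is the number of eigenvalues with
positive real part, and positive definite on one whose dimension is the number of those with
negative real part. An eigenvector `v` for `μ` is not isotropic, since `Re μ · h(v, v) < 0`; the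
compression of `f` to its `h`-orthogonal complement satisfies the same hypothesis. -/
theorem exists_definite_subspaces (m : ℕ) : ∀ {V : Type} [AddCommGroup V] [Module ℂ V]
    [FiniteDimensional ℂ V] (_ : Module.finrank ℂ V = m) (h : V →ₗ⋆[ℂ] V →ₗ[ℂ] ℂ)
    (_ : ∀ x y, (starRingEnd ℂ) (h x y) = h y x) (f : Module.End ℂ V)
    (_ : ∀ x, x ≠ 0 → (h x (f x)).re < 0),
    (∃ N : Submodule ℂ V, (∀ x ∈ N, x ≠ 0 → 0 < (-1) * (h x x).re) ∧
      Module.finrank ℂ N = f.charpoly.roots.countP (fun μ => 0 < μ.re)) ∧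
    (∃ N : Submodule ℂ V, (∀ x ∈ N, x ≠ 0 → 0 < 1 * (h x x).re) ∧
      Module.finrank ℂ N = f.charpoly.roots.countP (fun μ => μ.re < 0)) ∧
    (∀ μ ∈ f.charpoly.roots, μ.re ≠ 0) := by
  induction m with
  | zero =>
    intro V _ _ _ hV h hsym f hf
    have hroots : f.charpoly.roots = 0 := by
      have h1 : f.charpoly.natDegree = 0 := by rw [LinearMap.charpoly_natDegree, hV]
      rw [Polynomial.eq_one_of_monic_natDegree_zero f.charpoly_monic h1, Polynomial.roots_one]
      rfl
    simp only [hroots]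
    refine ⟨⟨⊥, ?_, by simp⟩, ⟨⊥, ?_, by simp⟩, by simp⟩ <;>
    · intro x hx hx0
      exact absurd ((Submodule.mem_bot ℂ).1 hx) hx0
  | succ m ih =>
    intro V _ _ _ hV h hsym f hf
    have : Nontrivial V := Module.nontrivial_of_finrank_pos (R := ℂ) (by omega)
    obtain ⟨μ, hμ⟩ := Module.End.exists_eigenvalue f
    obtain ⟨v, hv⟩ := hμ.exists_hasEigenvector
    have hfv : f v = μ • v := hv.apply_eq_smul
    have hv0 : v ≠ 0 := hv.2
    have him : (h v v).im = 0 := by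
      have := congrArg Complex.im (hsym v v)
      rw [Complex.conj_im] at this
      linarith
    have hμv : μ.re * (h v v).re < 0 := by
      have h1 := hf v hv0
      rw [hfv, map_smul, smul_eq_mul, Complex.mul_re, him] at h1
      linarith
    have hvv : h v v ≠ 0 := by
      intro h0
      rw [h0] at hμv
      simp at hμv
    let W : Submodule ℂ V := LinearMap.ker (h v)
    -- the `h`-orthogonal projection onto `W` along `v`
    let π : V →ₗ[ℂ] W := LinearMap.codRestrict W
      (LinearMap.id - (LinearMap.toSpanSingleton ℂ V v) ∘ₗ ((h v v)⁻¹ • h v)) (by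
        intro x
        rw [LinearMap.mem_ker]
        simp [mul_right_comm, inv_mul_cancel₀ hvv])
    have hπ : ∀ x, (π x : V) = x - ((h v v)⁻¹ * h v x) • v := fun x => by
      simp [π]
    let g : Module.End ℂ W := π ∘ₗ f ∘ₗ W.subtype
    let e : V ≃ₗ[ℂ] ℂ × W :=
      { toFun := fun x => ((h v v)⁻¹ * h v x, π x)
        map_add' := fun x y => by
          simp [mul_add]
        map_smul' := fun c x => by
          simp only [map_smul, smul_eq_mul, RingHom.id_apply, Prod.smul_mk]
          rw [mul_left_comm]
        invFun := fun p => p.1 • v + (p.2 : V)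
        left_inv := fun x => by
          simp [hπ]
        right_inv := fun p => by
          have h1 : h v (p.2 : V) = 0 := p.2.2
          have h2 : (h v v)⁻¹ * h v (p.1 • v + (p.2 : V)) = p.1 := by
            rw [map_add, h1, map_smul, smul_eq_mul, add_zero]; field_simp
          refine Prod.ext h2 (Subtype.ext ?_)
          simp only [hπ, h2]
          abel }
    have he1 : ∀ a : ℂ, e.symm (a, 0) = a • v := fun a => by
      change a • v + ((0 : W) : V) = _
      simp
    have he2 : ∀ w : W, e.symm (0, w) = w := fun w => by
      change (0 : ℂ) • v + (w : V) = _
      simp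
    have hπv : π v = 0 := Subtype.ext (by rw [hπ, inv_mul_cancel₀ hvv]; simp)
    have hchar : f.charpoly = (Polynomial.X - Polynomial.C μ) * g.charpoly := by
      rw [← e.charpoly_conj f, LinearMap.charpoly_eq_mul_of_triangular]
      · congr 1
        · have h1 : LinearMap.fst ℂ ℂ W ∘ₗ (e.conj f) ∘ₗ LinearMap.inl ℂ ℂ W
              = μ • LinearMap.id := by
            ext
            change (h v v)⁻¹ * h v (f (e.symm (1, 0))) = _
            rw [he1, one_smul, hfv, map_smul]
            simp only [smul_eq_mul, LinearMap.smul_apply, LinearMap.id_apply, mul_one]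
            field_simp
          rw [h1, ← LinearMap.charpoly_toMatrix _ (Module.Basis.singleton Unit ℂ), Matrix.charpoly,
            Matrix.det_unique, Matrix.charmatrix_apply_eq]
          simp [LinearMap.toMatrix_apply]
        · congr 1
          ext w
          change (π (f (e.symm (0, w))) : V) = π (f w)
          rw [he2]
      · intro x
        change π (f (e.symm (x, 0))) = 0
        rw [he1, map_smul, hfv, map_smul, map_smul, hπv]
        simp
    have hroots : f.charpoly.roots = μ ::ₘ g.charpoly.roots := by
      rw [hchar, Polynomial.roots_mul, Polynomial.roots_X_sub_C, Multiset.singleton_add]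
      exact mul_ne_zero (Polynomial.X_sub_C_ne_zero _) g.charpoly_monic.ne_zero
    have hW : Module.finrank ℂ W = m := by
      have h1 := e.finrank_eq
      rw [Module.finrank_prod, Module.finrank_self, hV] at h1
      omega
    let hWf : W →ₗ⋆[ℂ] W →ₗ[ℂ] ℂ := (LinearMap.lcomp ℂ ℂ W.subtype).comp (h.comp W.subtype)
    have hWf_apply : ∀ x y : W, hWf x y = h x y := fun x y => rfl
    have hwv : ∀ w : W, h w v = 0 := fun w => by
      rw [← hsym, show h v w = 0 from w.2, map_zero]
    obtain ⟨⟨N, hN, hNd⟩, ⟨Q, hQ, hQd⟩, hne⟩ := ih hW hWf (fun x y => hsym x y) g (by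
      intro x hx
      have h1 : hWf x (g x) = h x (f x) := by
        rw [hWf_apply]
        change h x (π (f x) : V) = _
        rw [hπ, map_sub, map_smul, hwv, smul_zero, sub_zero]
      rw [h1]
      exact hf x (by simpa using hx))
    have hperp : ∀ N : Submodule ℂ W, ∀ x ∈ N.map W.subtype, h v x = 0 := by
      rintro N _ ⟨x, -, rfl⟩
      exact x.2
    have hmap : ∀ (s : ℝ) (N : Submodule ℂ W), (∀ x ∈ N, x ≠ 0 → 0 < s * (hWf x x).re) →
        ∀ x ∈ N.map W.subtype, x ≠ 0 → 0 < s * (h x x).re := by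
      rintro s N hN _ ⟨x, hx, rfl⟩ hx0
      exact hN x hx (by rintro rfl; simp at hx0)
    have hdim : ∀ N : Submodule ℂ W, Module.finrank ℂ (N.map W.subtype) = Module.finrank ℂ N :=
      fun N => Submodule.finrank_map_subtype_eq W N
    rw [hroots]
    simp only [Multiset.countP_cons, ← hNd, ← hQd, ← hdim, Multiset.mem_cons, forall_eq_or_imp]
    have hre : μ.re ≠ 0 := by
      intro h0
      rw [h0, zero_mul] at hμv
      exact lt_irrefl _ hμv
    rcases lt_or_gt_of_ne hre with hneg | hpos
    · have hvpos : 0 < 1 * (h v v).re := by nlinarith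
      refine ⟨⟨N.map W.subtype, hmap _ N hN, by rw [if_neg hneg.le.not_gt, add_zero]⟩, ?_, hre, hne⟩
      rw [if_pos hneg]
      exact exists_definite_sup_span h hsym 1 v hvpos _ (hmap _ Q hQ) (hperp Q)
    · have hvneg : 0 < (-1) * (h v v).re := by nlinarith
      refine ⟨?_, ⟨Q.map W.subtype, hmap _ Q hQ, by rw [if_neg hpos.le.not_gt, add_zero]⟩, hre, hne⟩
      rw [if_pos hpos]
      exact exists_definite_sup_span h hsym (-1) v hvneg _ (hmap _ N hN) (hperp N)

/-- The real part of a Hermitian-type expression with a real matrix splits over the real and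
imaginary parts of the vector. -/
theorem re_star_dotProduct_map_mulVec {ι : Type*} [Fintype ι] (M : Matrix ι ι ℝ) (x : ι → ℂ) :
    (star x ⬝ᵥ (M.map Complex.ofReal *ᵥ x)).re
      = (fun i => (x i).re) ⬝ᵥ (M *ᵥ fun i => (x i).re)
        + (fun i => (x i).im) ⬝ᵥ (M *ᵥ fun i => (x i).im) := by
  simp only [dotProduct, Matrix.mulVec, Complex.re_sum, Finset.mul_sum, ← Finset.sum_add_distrib,
    Matrix.map_apply, Pi.star_apply]
  refine Finset.sum_congr rfl fun i _ => Finset.sum_congr rfl fun j _ => ?_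
  simp

theorem aroots_charpoly_eq {n : ℕ} (A : Matrix (Fin n) (Fin n) ℝ) :
    A.charpoly.aroots ℂ = (A.map Complex.ofReal).toLin'.charpoly.roots := by
  rw [Matrix.charpoly_toLin', Polynomial.aroots_def]
  congr 1
  exact (Matrix.charpoly_map A Complex.ofRealHom).symm

open scoped Classical in
theorem countP_re_add_countP_re (s : Multiset ℂ) (h : ∀ μ ∈ s, μ.re ≠ 0) :
    s.countP (fun μ => 0 < μ.re) + s.countP (fun μ => μ.re < 0) = s.card := by
  rw [Multiset.card_eq_countP_add_countP (fun μ => 0 < μ.re) s]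
  congr 1
  refine Multiset.countP_congr rfl fun μ hμ => ?_
  have := h μ hμ
  simp only [not_lt, eq_iff_iff]
  exact ⟨le_of_lt, fun h' => lt_of_le_of_ne h' this⟩

open scoped Classical in
/-- Lyapunov's inertia theorem: if `P A` has negative definite symmetric part, the symmetric matrix
`P` has as many negative eigenvalues as `A` has eigenvalues in the right half plane. Both `A`
(with the form of `P`) and `P` (with the form of `-P`) satisfy the hypothesis of
`exists_definite_subspaces`, and subspaces of opposite sign are disjoint. -/
theorem inertia_eq_of_lyapunov {n : ℕ} (A P : Matrix (Fin n) (Fin n) ℝ) (hP : P.IsSymm)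
    (hneg : ∀ x : Fin n → ℝ, x ≠ 0 → x ⬝ᵥ (P *ᵥ (A *ᵥ x)) < 0) :
    inertia P = ((A.charpoly.aroots ℂ).countP (fun μ => 0 < μ.re), 0,
      n - (A.charpoly.aroots ℂ).countP (fun μ => 0 < μ.re)) := by
  let h : (Fin n → ℂ) →ₗ⋆[ℂ] (Fin n → ℂ) →ₗ[ℂ] ℂ :=
    LinearMap.mk₂'ₛₗ (starRingEnd ℂ) (RingHom.id ℂ)
      (fun x y => star x ⬝ᵥ (P.map Complex.ofReal *ᵥ y))
      (fun x y z => by simp [add_dotProduct]) (fun c x y => by simp [smul_dotProduct])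
      (fun x y z => by simp [Matrix.mulVec_add, dotProduct_add])
      (fun c x y => by simp [Matrix.mulVec_smul])
  have h_apply : ∀ x y, h x y = star x ⬝ᵥ (P.map Complex.ofReal *ᵥ y) := fun x y => rfl
  have hsym : ∀ x y, (starRingEnd ℂ) (h x y) = h y x := by
    intro x y
    have hPH : (P.map Complex.ofReal)ᴴ = P.map Complex.ofReal := by
      ext i j
      simp [Matrix.conjTranspose_apply, hP.apply i j]
    rw [h_apply, h_apply, starRingEnd_apply, Matrix.star_dotProduct, star_star,
      Matrix.star_mulVec, hPH, Matrix.dotProduct_mulVec]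
  have hre : ∀ (M : Matrix (Fin n) (Fin n) ℝ),
      (∀ x : Fin n → ℝ, x ≠ 0 → x ⬝ᵥ (M *ᵥ x) < 0) →
      ∀ x : Fin n → ℂ, x ≠ 0 → (star x ⬝ᵥ (M.map Complex.ofReal *ᵥ x)).re < 0 := by
    intro M hM x hx
    rw [re_star_dotProduct_map_mulVec]
    have hle : ∀ a : Fin n → ℝ, a ⬝ᵥ (M *ᵥ a) ≤ 0 := fun a => by
      by_cases ha : a = 0
      · simp [ha]
      · exact (hM a ha).le
    by_cases ha : (fun i => (x i).re) = 0
    · have hb : (fun i => (x i).im) ≠ 0 := by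
        intro hb
        exact hx (funext fun i => Complex.ext (congrFun ha i) (congrFun hb i))
      have := hM _ hb
      have := hle fun i => (x i).re
      linarith
    · have := hM _ ha
      have := hle fun i => (x i).im
      linarith
  have hA : ∀ x, x ≠ 0 → (h x ((A.map Complex.ofReal).toLin' x)).re < 0 := by
    intro x hx
    rw [h_apply, Matrix.toLin'_apply, Matrix.mulVec_mulVec, ← map_ofReal_mul]
    refine hre _ (fun y hy => ?_) x hx
    rw [← Matrix.mulVec_mulVec]
    exact hneg y hy
  have hPpos : ∀ x, x ≠ 0 → ((-h) x ((P.map Complex.ofReal).toLin' x)).re < 0 := by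
    intro x hx
    have h1 : (-h) x ((P.map Complex.ofReal).toLin' x)
        = star x ⬝ᵥ ((-(P * P)).map Complex.ofReal *ᵥ x) := by
      have h2 : (-(P * P)).map Complex.ofReal
          = -(P.map Complex.ofReal * P.map Complex.ofReal) := by
        rw [← map_ofReal_mul]; ext; simp
      rw [h2, LinearMap.neg_apply, LinearMap.neg_apply, h_apply, Matrix.toLin'_apply,
        Matrix.mulVec_mulVec, Matrix.neg_mulVec, dotProduct_neg]
    rw [h1]
    refine hre _ (fun y hy => ?_) x hx
    have hPy : P *ᵥ y ≠ 0 := by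
      intro h0
      have h3 := hneg y hy
      rw [Matrix.dotProduct_mulVec, ← Matrix.mulVec_transpose, hP.eq, h0, zero_dotProduct] at h3
      exact lt_irrefl _ h3
    rw [Matrix.neg_mulVec, dotProduct_neg, ← Matrix.mulVec_mulVec, Matrix.dotProduct_mulVec,
      ← Matrix.mulVec_transpose, hP.eq, neg_lt_zero]
    exact lt_of_le_of_ne (Finset.sum_nonneg fun _ _ => mul_self_nonneg _)
      (fun h0 => hPy (dotProduct_self_eq_zero.1 h0.symm))
  have hn : Module.finrank ℂ (Fin n → ℂ) = n := by simp
  obtain ⟨⟨N, hN, hNd⟩, ⟨Q, hQ, hQd⟩, hne⟩ := exists_definite_subspaces n hn h hsym _ hA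
  obtain ⟨⟨N', hN', hNd'⟩, ⟨Q', hQ', hQd'⟩, hne'⟩ := exists_definite_subspaces n hn (-h)
    (fun x y => by simp [hsym]) _ hPpos
  have hdisj : ∀ (U W : Submodule ℂ (Fin n → ℂ)), (∀ x ∈ U, x ≠ 0 → (h x x).re < 0) →
      (∀ x ∈ W, x ≠ 0 → 0 < (h x x).re) → Module.finrank ℂ U + Module.finrank ℂ W ≤ n := by
    intro U W hU hW
    have h1 := Submodule.finrank_add_finrank_le_of_disjoint (s := U) (t := W) (by
      rw [Submodule.disjoint_def]
      intro x hxU hxW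
      by_contra hx
      exact lt_asymm (hU x hxU hx) (hW x hxW hx))
    rwa [hn] at h1
  have h1 := hdisj N N' (fun x hx h0 => by have := hN x hx h0; linarith)
    (fun x hx h0 => by
      have := hN' x hx h0
      simp only [LinearMap.neg_apply, Complex.neg_re] at this
      linarith)
  have h2 := hdisj Q' Q (fun x hx h0 => by
      have := hQ' x hx h0
      simp only [LinearMap.neg_apply, Complex.neg_re] at this
      linarith)
    (fun x hx h0 => by have := hQ x hx h0; linarith)
  have hcard : ∀ M : Matrix (Fin n) (Fin n) ℝ,
      ((M.map Complex.ofReal).toLin'.charpoly.roots).card = n := by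
    intro M
    rw [IsAlgClosed.card_roots_eq_natDegree, LinearMap.charpoly_natDegree, hn]
  have hcA := countP_re_add_countP_re _ hne
  have hcP := countP_re_add_countP_re _ hne'
  rw [hcard] at hcA hcP
  rw [hNd, hNd'] at h1
  rw [hQd, hQd'] at h2
  unfold inertia
  rw [aroots_charpoly_eq, aroots_charpoly_eq]
  refine Prod.ext ?_ (Prod.ext ?_ ?_)
  · simp only; omega
  · exact Multiset.countP_eq_zero.2 fun μ hμ => hne' μ hμ
  · simp only; omega

/-! ### The argument principle along a vertical line -/

/-- `θ` is a continuous argument of the curve `γ`, tending to `a` and `b` at the two ends. -/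
structure IsArgumentAlong (γ : ℝ → ℂ) (θ : ℝ → ℝ) (a b : ℝ) : Prop where
  continuous : Continuous θ
  eq_norm_mul_exp : ∀ ω, γ ω = (‖γ ω‖ : ℂ) * Complex.exp ((θ ω : ℂ) * Complex.I)
  tendsto_atBot : Filter.Tendsto θ Filter.atBot (𝓝 a)
  tendsto_atTop : Filter.Tendsto θ Filter.atTop (𝓝 b)

theorem IsArgumentAlong.mul {γ γ' : ℝ → ℂ} {θ θ' : ℝ → ℝ} {a b a' b' : ℝ}
    (h : IsArgumentAlong γ θ a b) (h' : IsArgumentAlong γ' θ' a' b') :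
    IsArgumentAlong (fun ω => γ ω * γ' ω) (fun ω => θ ω + θ' ω) (a + a') (b + b') where
  continuous := h.continuous.add h'.continuous
  eq_norm_mul_exp ω := by
    conv_lhs => rw [h.eq_norm_mul_exp ω, h'.eq_norm_mul_exp ω]
    rw [norm_mul, Complex.ofReal_add, add_mul, Complex.exp_add]
    push_cast
    ring
  tendsto_atBot := h.tendsto_atBot.add h'.tendsto_atBot
  tendsto_atTop := h.tendsto_atTop.add h'.tendsto_atTop

/-- Two continuous arguments of the same nowhere vanishing curve have the same total change. -/
theorem IsArgumentAlong.sub_eq {γ : ℝ → ℂ} {θ θ' : ℝ → ℝ} {a b a' b' : ℝ}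
    (h : IsArgumentAlong γ θ a b) (h' : IsArgumentAlong γ θ' a' b') (hγ : ∀ ω, γ ω ≠ 0) :
    b - a = b' - a' := by
  have hmem : Set.MapsTo (fun ω => θ ω - θ' ω) Set.univ
      (AddSubgroup.zmultiples (2 * Real.pi) : Set ℝ) := by
    intro ω _
    have h1 : (‖γ ω‖ : ℂ) ≠ 0 := by exact_mod_cast norm_ne_zero_iff.2 (hγ ω)
    have h2 := mul_left_cancel₀ h1 ((h.eq_norm_mul_exp ω).symm.trans (h'.eq_norm_mul_exp ω))
    obtain ⟨m, hm⟩ := Complex.exp_eq_exp_iff_exists_int.1 h2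
    refine ⟨m, ?_⟩
    have h3 := congrArg Complex.im hm
    simp at h3
    simp only [zsmul_eq_mul]
    linarith
  have hconst : ∀ x y, θ x - θ' x = θ y - θ' y := fun x y =>
    isPreconnected_univ.constant_of_mapsTo
      (isDiscrete_iff_discreteTopology.2 (inferInstanceAs (DiscreteTopology
        (AddSubgroup.zmultiples (2 * Real.pi)))))
      (h.continuous.sub h'.continuous).continuousOn hmem (Set.mem_univ x) (Set.mem_univ y)
  have h1 : (fun ω => θ ω - θ' ω) = fun _ => θ 0 - θ' 0 := funext fun x => hconst x 0
  have hbot := h.tendsto_atBot.sub h'.tendsto_atBot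
  have htop := h.tendsto_atTop.sub h'.tendsto_atTop
  rw [h1] at hbot htop
  have := tendsto_nhds_unique hbot tendsto_const_nhds
  have := tendsto_nhds_unique htop tendsto_const_nhds
  linarith

/-- The point `iω` sees a point `β` off the imaginary axis under the angle
`arctan ((ω - Im β) / (-Re β))`, up to a half turn when `β` is on the right. -/
theorem isArgumentAlong_sub {β : ℂ} (hβ : β.re ≠ 0) :
    ∃ θ a b, IsArgumentAlong (fun ω => Complex.I * (ω : ℂ) - β) θ a b ∧
      b - a = Real.pi * (1 - 2 * if 0 < β.re then 1 else 0) := by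
  have hcos : ∀ ω : ℝ, 0 < Real.cos (Real.arctan ((ω - β.im) / (-β.re))) :=
    fun ω => Real.cos_arctan_pos _
  -- both coordinates of `iω - β`, up to the positive factor `r`
  have hpolar : ∀ (ω r θ : ℝ), 0 < r → -β.re = r * Real.cos θ → ω - β.im = r * Real.sin θ →
      Complex.I * (ω : ℂ) - β = (‖Complex.I * (ω : ℂ) - β‖ : ℂ) *
        Complex.exp ((θ : ℂ) * Complex.I) := by
    intro ω r θ hr h1 h2
    have h3 : Complex.I * (ω : ℂ) - β = (r : ℂ) * Complex.exp ((θ : ℂ) * Complex.I) := by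
      apply Complex.ext
      · simp [Complex.exp_ofReal_mul_I_re, ← h1]
      · simp [Complex.exp_ofReal_mul_I_im, ← h2]
    rw [h3, norm_mul, Complex.norm_exp_ofReal_mul_I, mul_one, Complex.norm_real,
      Real.norm_of_nonneg hr.le]
  have hsin : ∀ ω : ℝ, (-β.re) * Real.sin (Real.arctan ((ω - β.im) / (-β.re)))
      = (ω - β.im) * Real.cos (Real.arctan ((ω - β.im) / (-β.re))) := by
    intro ω
    have h1 := Real.tan_arctan ((ω - β.im) / (-β.re))
    rw [Real.tan_eq_sin_div_cos, div_eq_div_iff (hcos ω).ne' (neg_ne_zero.2 hβ)] at h1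
    linarith
  rcases lt_or_gt_of_ne hβ with hneg | hpos
  · refine ⟨fun ω => Real.arctan ((ω - β.im) / (-β.re)), -(Real.pi / 2), Real.pi / 2,
      ⟨by fun_prop, fun ω => ?_, ?_, ?_⟩, by rw [if_neg hneg.le.not_gt]; ring⟩
    · refine hpolar ω (-β.re / Real.cos (Real.arctan ((ω - β.im) / (-β.re)))) _
        (div_pos (by linarith) (hcos ω)) ?_ ?_
      · rw [div_mul_cancel₀ _ (hcos ω).ne']
      · rw [div_mul_eq_mul_div, hsin, mul_div_cancel_right₀ _ (hcos ω).ne']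
    · refine (tendsto_nhds_of_tendsto_nhdsWithin Real.tendsto_arctan_atBot).comp ?_
      exact (Filter.tendsto_atBot_add_const_right _ (-β.im) Filter.tendsto_id).atBot_div_const
        (by linarith)
    · refine (tendsto_nhds_of_tendsto_nhdsWithin Real.tendsto_arctan_atTop).comp ?_
      exact (Filter.tendsto_atTop_add_const_right _ (-β.im) Filter.tendsto_id).atTop_div_const
        (by linarith)
  · refine ⟨fun ω => Real.arctan ((ω - β.im) / (-β.re)) + Real.pi, Real.pi / 2 + Real.pi,
      -(Real.pi / 2) + Real.pi, ⟨by fun_prop, fun ω => ?_, ?_, ?_⟩, by rw [if_pos hpos]; ring⟩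
    · refine hpolar ω (β.re / Real.cos (Real.arctan ((ω - β.im) / (-β.re)))) _
        (div_pos hpos (hcos ω)) ?_ ?_
      · rw [Real.cos_add_pi, mul_neg, div_mul_cancel₀ _ (hcos ω).ne']
      · rw [Real.sin_add_pi, mul_neg, div_mul_eq_mul_div, ← neg_div, ← neg_mul, hsin,
          mul_div_cancel_right₀ _ (hcos ω).ne']
    · refine Filter.Tendsto.add_const _
        ((tendsto_nhds_of_tendsto_nhdsWithin Real.tendsto_arctan_atTop).comp ?_)
      simp only [div_eq_mul_inv]
      exact (Filter.tendsto_atBot_add_const_right _ (-β.im) Filter.tendsto_id).atBot_mul_const_of_neg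
        (inv_lt_zero.2 (by linarith))
    · refine Filter.Tendsto.add_const _
        ((tendsto_nhds_of_tendsto_nhdsWithin Real.tendsto_arctan_atBot).comp ?_)
      simp only [div_eq_mul_inv]
      exact (Filter.tendsto_atTop_add_const_right _ (-β.im) Filter.tendsto_id).atTop_mul_const_of_neg
        (inv_lt_zero.2 (by linarith))

open scoped Classical in
/-- Along the imaginary axis the argument of a monic polynomial increases by `π` for each root on
the left and decreases by `π` for each root on the right. -/
theorem exists_isArgumentAlong_prod (s : Multiset ℂ) (hs : ∀ β ∈ s, β.re ≠ 0) :
    ∃ θ a b, IsArgumentAlong (fun ω => (s.map fun β => Complex.I * (ω : ℂ) - β).prod) θ a b ∧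
      b - a = Real.pi * (s.card - 2 * (s.countP (fun β => 0 < β.re) : ℕ)) := by
  induction s using Multiset.induction_on with
  | empty =>
    exact ⟨fun _ => 0, 0, 0, ⟨continuous_const, by simp, tendsto_const_nhds, tendsto_const_nhds⟩,
      by simp⟩
  | cons β s ih =>
    obtain ⟨θ, a, b, h, hab⟩ := ih fun γ hγ => hs γ (Multiset.mem_cons_of_mem hγ)
    obtain ⟨θ', a', b', h', hab'⟩ := isArgumentAlong_sub (hs β (Multiset.mem_cons_self β s))
    refine ⟨_, _, _, by simpa only [Multiset.map_cons, Multiset.prod_cons] using h'.mul h, ?_⟩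
    rw [Multiset.card_cons, Multiset.countP_cons]
    have : b' + b - (a' + a) = (b' - a') + (b - a) := by ring
    rw [this, hab, hab']
    split_ifs <;> push_cast <;> ring

open scoped Classical in
/-- If `γ p = k q` along the imaginary axis, with `p` and `q` monic of the same degree, without
imaginary roots, and `k ≠ 0` real, the argument of `γ` changes by `2π` times the number of roots of
`p` on the right minus that of `q`. -/
theorem IsArgumentAlong.sub_eq_countP_sub_countP {γ : ℝ → ℂ} {θ : ℝ → ℝ} {a b : ℝ}
    (h : IsArgumentAlong γ θ a b) {p q : Polynomial ℂ} (hp : p.Monic) (hq : q.Monic)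
    (hdeg : p.natDegree = q.natDegree) (hp0 : ∀ β ∈ p.roots, β.re ≠ 0)
    (hq0 : ∀ β ∈ q.roots, β.re ≠ 0) {k : ℝ} (hk : k ≠ 0)
    (heq : ∀ ω : ℝ, γ ω * p.eval (Complex.I * ω) = k * q.eval (Complex.I * ω)) :
    b - a = 2 * Real.pi * ((p.roots.countP (fun β => 0 < β.re) : ℕ)
      - (q.roots.countP (fun β => 0 < β.re) : ℕ)) := by
  have heval : ∀ r : Polynomial ℂ, r.Monic → ∀ ω : ℝ, r.eval (Complex.I * ω)
      = (r.roots.map fun β => Complex.I * (ω : ℂ) - β).prod := fun r hr ω =>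
    (IsAlgClosed.splits r).eval_eq_prod_roots_of_monic hr _
  obtain ⟨θp, ap, bp, hθp, hpab⟩ := exists_isArgumentAlong_prod p.roots hp0
  obtain ⟨θq, aq, bq, hθq, hqab⟩ := exists_isArgumentAlong_prod q.roots hq0
  have hkarg : IsArgumentAlong (fun _ => (k : ℂ)) (fun _ => Complex.arg k) (Complex.arg k)
      (Complex.arg k) :=
    ⟨continuous_const, fun _ => (Complex.norm_mul_exp_arg_mul_I _).symm, tendsto_const_nhds,
      tendsto_const_nhds⟩
  have h1 := h.mul hθp
  have h2 := hkarg.mul hθq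
  have hfun : (fun ω : ℝ => γ ω * (p.roots.map fun β => Complex.I * (ω : ℂ) - β).prod)
      = fun ω : ℝ => (k : ℂ) * (q.roots.map fun β => Complex.I * (ω : ℂ) - β).prod := by
    funext ω
    rw [← heval p hp, ← heval q hq, heq]
  rw [hfun] at h1
  have h3 := h1.sub_eq h2 (fun ω => by
    refine mul_ne_zero (by exact_mod_cast hk) ?_
    rw [← heval q hq]
    intro h0
    exact hq0 _ ((Polynomial.mem_roots hq.ne_zero).2 h0) (by simp))
  rw [IsAlgClosed.card_roots_eq_natDegree] at hpab hqab
  rw [hdeg] at hpab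
  linarith

theorem charpoly_add_smul_one {n : ℕ} (A : Matrix (Fin n) (Fin n) ℝ) (l : ℝ) :
    (A + l • (1 : Matrix (Fin n) (Fin n) ℝ)).charpoly
      = A.charpoly.comp (Polynomial.X + Polynomial.C (-l)) := by
  rw [← Matrix.charpoly_sub_scalar]
  congr 1
  ext i j
  simp only [Matrix.add_apply, Matrix.sub_apply, Matrix.smul_apply, Matrix.one_apply,
    Matrix.scalar_apply, Matrix.diagonal_apply, smul_eq_mul]
  split_ifs <;> ring

theorem aroots_charpoly_add_smul_one {n : ℕ} (A : Matrix (Fin n) (Fin n) ℝ) (l : ℝ) :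
    (A + l • (1 : Matrix (Fin n) (Fin n) ℝ)).charpoly.aroots ℂ
      = (A.charpoly.aroots ℂ).map fun μ => μ + (l : ℂ) := by
  have h2 : A.charpoly.map (algebraMap ℝ ℂ) =
      ((A + l • (1 : Matrix (Fin n) (Fin n) ℝ)).charpoly.map (algebraMap ℝ ℂ)).comp
        (Polynomial.C 1 * Polynomial.X + Polynomial.C (l : ℂ)) := by
    rw [charpoly_add_smul_one, Polynomial.map_comp, Polynomial.comp_assoc]
    simp
  rw [Polynomial.aroots_def, Polynomial.aroots_def, h2,
    ← Polynomial.map_roots_comp_C_mul_X_add_C _ 1 (l : ℂ) isUnit_one]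
  simp

/-! ### The frequency response -/

namespace SISOSystem

variable {n : ℕ}

theorem IsMinimal.num_eq {S : SISOSystem n} (h : S.IsMinimal) :
    S.transfer.num = S.strictNum + Polynomial.C S.D * S.A.charpoly := by
  have ha := S.A.charpoly_monic.ne_zero
  have ha' := RatFunc.algebraMap_ne_zero ha
  have h1 : S.transfer = algebraMap (Polynomial ℝ) (RatFunc ℝ)
      (S.strictNum + Polynomial.C S.D * S.A.charpoly) /
      algebraMap (Polynomial ℝ) (RatFunc ℝ) S.A.charpoly := by
    rw [S.transfer_eq, map_add, map_mul, RatFunc.algebraMap_C]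
    field_simp
  have h2 := (RatFunc.num_mul_eq_mul_denom_iff ha).2 h1
  rw [h.denom_eq_charpoly] at h2
  exact mul_right_cancel₀ ha h2

theorem IsMinimal.eval_transfer_mul {S : SISOSystem n} (h : S.IsMinimal) {s : ℂ}
    (hs : Polynomial.aeval s S.A.charpoly ≠ 0) :
    S.transfer.eval (algebraMap ℝ ℂ) s * Polynomial.aeval s S.A.charpoly
      = Polynomial.aeval s S.strictNum + S.D * Polynomial.aeval s S.A.charpoly := by
  rw [RatFunc.eval, h.denom_eq_charpoly, h.num_eq, ← Polynomial.aeval_def, ← Polynomial.aeval_def,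
    div_mul_cancel₀ _ hs]
  simp

/-- The state response to `u e^{st}`: `s x = A x + B u` gives `det (s - A) x = adj (s - A) B u`. -/
theorem charpoly_smul_state (S : SISOSystem n) {s u : ℂ} {x : Fin n → ℂ}
    (hx : S.A.map Complex.ofReal *ᵥ x + u • (Complex.ofReal ∘ S.B) = s • x) :
    Polynomial.aeval s S.A.charpoly • x = u •
      (S.A.charmatrix.adjugate.map (Polynomial.aeval s) *ᵥ (Complex.ofReal ∘ S.B)) := by
  let f : Polynomial ℝ →+* ℂ := (Polynomial.aeval s).toRingHom
  have h1 : S.A.charmatrix.map f *ᵥ x = u • (Complex.ofReal ∘ S.B) := by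
    have h2 : S.A.charmatrix.map f = s • (1 : Matrix (Fin n) (Fin n) ℂ) - S.A.map Complex.ofReal := by
      ext i j
      by_cases hij : i = j
      · subst hij; simp [f, Matrix.charmatrix_apply_eq]
      · simp [f, hij]
    rw [h2, Matrix.sub_mulVec, Matrix.smul_mulVec, Matrix.one_mulVec, ← hx, add_sub_cancel_left]
  have h3 : (S.A.charmatrix.map f).adjugate = S.A.charmatrix.adjugate.map f := by
    rw [← RingHom.mapMatrix_apply, ← RingHom.map_adjugate]; rfl
  have h4 : (S.A.charmatrix.map f).det = Polynomial.aeval s S.A.charpoly := by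
    rw [← RingHom.mapMatrix_apply, ← RingHom.map_det]; rfl
  have h5 := congrArg (fun v => (S.A.charmatrix.map f).adjugate *ᵥ v) h1
  simp only [Matrix.mulVec_mulVec, Matrix.adjugate_mul, Matrix.smul_mulVec, Matrix.one_mulVec,
    Matrix.mulVec_smul] at h5
  rw [h4, h3] at h5
  exact h5

theorem aeval_strictNum (S : SISOSystem n) (s : ℂ) :
    Polynomial.aeval s S.strictNum = (Complex.ofReal ∘ S.C) ⬝ᵥ
      (S.A.charmatrix.adjugate.map (Polynomial.aeval s) *ᵥ (Complex.ofReal ∘ S.B)) := by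
  simp [strictNum, dotProduct, Matrix.mulVec, map_sum]

theorem IsMinimal.output_eq {S : SISOSystem n} (h : S.IsMinimal) {s u : ℂ} {x : Fin n → ℂ}
    (hs : Polynomial.aeval s S.A.charpoly ≠ 0)
    (hx : S.A.map Complex.ofReal *ᵥ x + u • (Complex.ofReal ∘ S.B) = s • x) :
    (Complex.ofReal ∘ S.C) ⬝ᵥ x + S.D * u = S.transfer.eval (algebraMap ℝ ℂ) s * u := by
  have h1 := congrArg (fun v => (Complex.ofReal ∘ S.C) ⬝ᵥ v) (S.charpoly_smul_state hx)
  simp only [dotProduct_smul, smul_eq_mul, ← aeval_strictNum] at h1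
  have h2 := h.eval_transfer_mul hs
  apply mul_left_cancel₀ hs
  linear_combination h1 - u * h2

theorem IsMinimal.aeval_charpoly_ne_zero {S : SISOSystem n} (h : S.IsMinimal) {l : ℝ}
    (hpoles : ∀ s ∈ frontier (nyquistRegion l), s ∉ S.poles) (ω : ℝ) :
    Polynomial.aeval (Complex.I * (ω : ℂ) - (l : ℂ)) S.A.charpoly ≠ 0 := by
  intro h0
  have hreg : nyquistRegion l = {s : ℂ | -l < s.re} := by
    ext s
    simp only [nyquistRegion, Set.mem_ofPred_eq, Complex.add_re, Complex.ofReal_re]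
    constructor <;> intro h <;> linarith
  refine hpoles (Complex.I * (ω : ℂ) - (l : ℂ)) ?_ ?_
  · rw [hreg, Complex.frontier_setOfPred_lt_re]
    simp
  · rw [poles, h.denom_eq_charpoly, Polynomial.mem_aroots]
    exact ⟨S.A.charpoly_monic.ne_zero, h0⟩

open scoped Classical in
theorem IsMinimal.numPolesIn_eq {S : SISOSystem n} (h : S.IsMinimal) (l : ℝ) :
    S.numPolesIn l = ((S.A + l • (1 : Matrix (Fin n) (Fin n) ℝ)).charpoly.aroots ℂ).countP
      (fun μ => 0 < μ.re) := by
  rw [numPolesIn, poles, h.denom_eq_charpoly, aroots_charpoly_add_smul_one, Multiset.countP_map,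
    Multiset.countP_eq_card_filter]
  rfl

/-- The roots of `det (s I - (A - κ B C))`, `κ = K / (1 + K D)`, are the zeros of `1 + K G`, so the
encirclements of `-1 / K` count the eigenvalues of the closed loop with the constant gain `K`. -/
theorem IsMinimal.countP_closedLoop {S : SISOSystem n} (h : S.IsMinimal) {l K : ℝ} {E : ℤ}
    (hK : K ≠ 0) (hpoles : ∀ s ∈ frontier (nyquistRegion l), s ∉ S.poles)
    (henc : ClockwiseEncirclements (S.nyquistCurve l) ((-1 / K : ℝ) : ℂ) E) :
    (((S.A - (K / (1 + K * S.D)) • Matrix.vecMulVec S.B S.C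
      + l • (1 : Matrix (Fin n) (Fin n) ℝ)).charpoly.aroots ℂ).countP (fun μ => 0 < μ.re) : ℤ)
      = S.numPolesIn l + E := by
  classical
  obtain ⟨hne, θ, a, b, hθ, harg, ha, hb, hab⟩ := henc
  have hD : 1 + K * S.D ≠ 0 := by
    intro h0
    refine hne none ?_
    change (S.D : ℂ) = _
    rw [Complex.ofReal_inj]
    field_simp
    linarith
  set A₁ := S.A - (K / (1 + K * S.D)) • Matrix.vecMulVec S.B S.C with hA₁
  have hA₁char : ∀ s : ℂ, Polynomial.aeval s A₁.charpoly = Polynomial.aeval s S.A.charpoly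
      + (K / (1 + K * S.D) : ℝ) * Polynomial.aeval s S.strictNum := by
    intro s
    rw [hA₁, S.charpoly_feedback]
    simp
  have hshift : ∀ (X : Matrix (Fin n) (Fin n) ℝ) (s : ℂ),
      (((X + l • (1 : Matrix (Fin n) (Fin n) ℝ)).charpoly.map (algebraMap ℝ ℂ)).eval s)
        = Polynomial.aeval (s - l) X.charpoly := by
    intro X s
    rw [charpoly_add_smul_one, Polynomial.eval_map_algebraMap, Polynomial.aeval_comp]
    simp [sub_eq_add_neg]
  have hkey : ∀ ω : ℝ, (S.nyquistCurve l ω - ((-1 / K : ℝ) : ℂ)) *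
      Polynomial.aeval (Complex.I * (ω : ℂ) - (l : ℂ)) S.A.charpoly
      = ((1 + K * S.D) / K : ℝ) *
        Polynomial.aeval (Complex.I * (ω : ℂ) - (l : ℂ)) A₁.charpoly := by
    intro ω
    have h1 := h.eval_transfer_mul (h.aeval_charpoly_ne_zero hpoles ω)
    have h2 : S.nyquistCurve l ω
        = S.transfer.eval (algebraMap ℝ ℂ) (Complex.I * (ω : ℂ) - (l : ℂ)) := rfl
    rw [hA₁char, h2, sub_mul, h1]
    have hK' : (K : ℂ) ≠ 0 := by exact_mod_cast hK
    have h3 : (((1 + K * S.D) / K : ℝ) : ℂ) * ((K / (1 + K * S.D) : ℝ) : ℂ) = 1 := by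
      rw [← Complex.ofReal_mul, div_mul_div_cancel₀ hK, div_self hD, Complex.ofReal_one]
    have h4 : (((1 + K * S.D) / K : ℝ) : ℂ) = S.D - ((-1 / K : ℝ) : ℂ) := by
      push_cast
      field_simp
      ring
    linear_combination -Polynomial.aeval (Complex.I * (ω : ℂ) - (l : ℂ)) S.strictNum * h3
      - Polynomial.aeval (Complex.I * (ω : ℂ) - (l : ℂ)) S.A.charpoly * h4
  have hroot : ∀ X : Matrix (Fin n) (Fin n) ℝ,
      (∀ ω : ℝ, Polynomial.aeval (Complex.I * (ω : ℂ) - (l : ℂ)) X.charpoly ≠ 0) →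
      ∀ β ∈ ((X + l • (1 : Matrix (Fin n) (Fin n) ℝ)).charpoly.map (algebraMap ℝ ℂ)).roots,
        β.re ≠ 0 := by
    intro X hX β hβ h0
    have h1 := (Polynomial.mem_roots'.1 hβ).2
    rw [Polynomial.IsRoot, hshift] at h1
    apply hX β.im
    have h2 : Complex.I * (β.im : ℂ) = β := by apply Complex.ext <;> simp [h0]
    rw [h2, h1]
  have hmonic : ∀ X : Matrix (Fin n) (Fin n) ℝ, (X.charpoly.map (algebraMap ℝ ℂ)).Monic :=
    fun X => X.charpoly_monic.map _
  have hcount := IsArgumentAlong.sub_eq_countP_sub_countP (γ := fun ω : ℝ =>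
      S.nyquistCurve l ω - ((-1 / K : ℝ) : ℂ)) ⟨hθ, harg, ha, hb⟩
    (hmonic (S.A + l • (1 : Matrix (Fin n) (Fin n) ℝ)))
    (hmonic (A₁ + l • (1 : Matrix (Fin n) (Fin n) ℝ)))
    (by simp [(Matrix.charpoly_monic _).natDegree_map])
    (hroot S.A fun ω => h.aeval_charpoly_ne_zero hpoles ω)
    (hroot A₁ fun ω h0 => by
      have h1 := hkey ω
      rw [h0, mul_zero, mul_eq_zero] at h1
      rcases h1 with h1 | h1
      · exact hne ω (sub_eq_zero.1 h1)
      · exact h.aeval_charpoly_ne_zero hpoles ω h1)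
    (div_ne_zero hD hK)
    (fun ω => by rw [hshift, hshift]; exact hkey ω)
  rw [hab] at hcount
  have hpi := Real.pi_pos
  rw [h.numPolesIn_eq, Polynomial.aroots_def, Polynomial.aroots_def]
  have h2 : -(E : ℝ) = _ := mul_left_cancel₀ (mul_pos two_pos hpi).ne'
    ((by ring : 2 * Real.pi * -(E : ℝ) = _).trans hcount)
  have h3 : (((A₁ + l • (1 : Matrix (Fin n) (Fin n) ℝ)).charpoly.map (algebraMap ℝ ℂ)).roots.countP
      (fun μ => 0 < μ.re) : ℝ) = (((S.A + l • (1 : Matrix (Fin n) (Fin n) ℝ)).charpoly.map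
      (algebraMap ℝ ℂ)).roots.countP (fun μ => 0 < μ.re) : ℝ) + E := by linarith
  convert (by exact_mod_cast h3 : (((A₁ + l • (1 : Matrix (Fin n) (Fin n) ℝ)).charpoly.map
    (algebraMap ℝ ℂ)).roots.countP (fun μ => 0 < μ.re) : ℤ) = (((S.A + l •
    (1 : Matrix (Fin n) (Fin n) ℝ)).charpoly.map
    (algebraMap ℝ ℂ)).roots.countP (fun μ => 0 < μ.re) : ℤ) + E)

end SISOSystem

/-! ### The circle condition -/

/-- `|z + c|² - r² = (1 + (K₁ + K₂) Re z + K₁ K₂ |z|²) / (K₁ K₂)` for the centre `-c` and the radius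
`r` of the disc. -/
theorem circleDisc_power {K₁ K₂ : ℝ} (h₁ : K₁ ≠ 0) (h₂ : K₂ ≠ 0) (z : ℂ) :
    (z.re + (K₁ + K₂) / (2 * K₁ * K₂)) ^ 2 + z.im ^ 2 - ((K₂ - K₁) / (2 * K₁ * K₂)) ^ 2
      = (1 + (K₁ + K₂) * z.re + K₁ * K₂ * (z.re ^ 2 + z.im ^ 2)) / (K₁ * K₂) := by
  field_simp
  ring

theorem lt_of_mem_interior_circleDisc {K₁ K₂ : ℝ} (hne : (K₂ - K₁) / (2 * K₁ * K₂) ≠ 0) {z : ℂ}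
    (hz : z ∈ interior (circleDisc K₁ K₂)) :
    (z.re + (K₁ + K₂) / (2 * K₁ * K₂)) ^ 2 + z.im ^ 2 < ((K₂ - K₁) / (2 * K₁ * K₂)) ^ 2 := by
  set c := (K₁ + K₂) / (2 * K₁ * K₂)
  set r := (K₂ - K₁) / (2 * K₁ * K₂)
  have hnorm : ∀ w : ℂ, (w.re + c) ^ 2 + w.im ^ 2 = dist w (-(c : ℂ)) ^ 2 := by
    intro w
    rw [Complex.dist_eq, sub_neg_eq_add, Complex.sq_norm, Complex.normSq_apply]
    simp
    ring
  have hball : circleDisc K₁ K₂ = Metric.closedBall (-(c : ℂ)) |r| := by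
    ext w
    rw [Metric.mem_closedBall, ← abs_of_nonneg (dist_nonneg (x := w) (y := -(c : ℂ))),
      ← sq_le_sq, ← hnorm]
    rfl
  rw [hball, interior_closedBall _ (abs_ne_zero.2 hne), Metric.mem_ball] at hz
  rw [hnorm, ← sq_abs r]
  exact pow_lt_pow_left₀ hz dist_nonneg two_ne_zero

/-- In all three cases the circle condition says `Re ((1 + K₁ z)^* (1 + K₂ z)) > 0` along the
Nyquist plot. -/
theorem circle_condition {K₁ K₂ : ℝ} {N : Set ℂ}
    (h : (0 < K₁ ∧ K₁ < K₂ ∧ N ⊆ (circleDisc K₁ K₂)ᶜ) ∨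
      (K₁ < 0 ∧ 0 < K₂ ∧ N ⊆ interior (circleDisc K₁ K₂)) ∨
      (K₁ < K₂ ∧ K₂ < 0 ∧ N ⊆ (circleDisc K₁ K₂)ᶜ)) :
    K₁ ≠ 0 ∧ K₁ < K₂ ∧
      ∀ z ∈ N, 0 < 1 + (K₁ + K₂) * z.re + K₁ * K₂ * (z.re ^ 2 + z.im ^ 2) := by
  have hout : ∀ z : ℂ, K₁ ≠ 0 → K₂ ≠ 0 → 0 < K₁ * K₂ → z ∈ (circleDisc K₁ K₂)ᶜ →
      0 < 1 + (K₁ + K₂) * z.re + K₁ * K₂ * (z.re ^ 2 + z.im ^ 2) := by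
    intro z h₁ h₂ hpos hz
    have h3 : ((K₂ - K₁) / (2 * K₁ * K₂)) ^ 2 < (z.re + (K₁ + K₂) / (2 * K₁ * K₂)) ^ 2 + z.im ^ 2 :=
      not_le.1 hz
    have h4 := sub_pos.2 h3
    rw [circleDisc_power h₁ h₂] at h4
    exact (div_pos_iff_of_pos_right hpos).1 h4
  rcases h with ⟨h1, h2, h3⟩ | ⟨h1, h2, h3⟩ | ⟨h1, h2, h3⟩
  · exact ⟨h1.ne', h2, fun z hz => hout z h1.ne' (h1.trans h2).ne' (mul_pos h1 (h1.trans h2)) (h3 hz)⟩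
  · refine ⟨h1.ne, h1.trans h2, fun z hz => ?_⟩
    have hneg : K₁ * K₂ < 0 := mul_neg_of_neg_of_pos h1 h2
    have h4 := sub_neg.2 (lt_of_mem_interior_circleDisc
      (div_ne_zero (sub_ne_zero.2 (h1.trans h2).ne')
        (by rw [mul_assoc]; exact mul_ne_zero two_ne_zero hneg.ne)) (h3 hz))
    rw [circleDisc_power h1.ne h2.ne'] at h4
    by_contra hcon
    exact absurd h4 (not_lt.2 (div_nonneg_of_nonpos (not_lt.1 hcon) hneg.le))
  · exact ⟨(h1.trans h2).ne, h1, fun z hz => hout z (h1.trans h2).ne h2.ne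
      (mul_pos_of_neg_of_neg (h1.trans h2) h2) (h3 hz)⟩

/-! ### The feedback loop -/

theorem exists_differentiable_inverse_of_le_deriv {ψ ψ' : ℝ → ℝ} {m : ℝ} (hm : 0 < m)
    (hψ : ∀ y, HasDerivAt ψ (ψ' y) y) (hle : ∀ y, m ≤ ψ' y) :
    ∃ η : ℝ → ℝ, (∀ y, η (ψ y) = y) ∧ (∀ r, ψ (η r) = r) ∧
      ∀ r, HasDerivAt η (ψ' (η r))⁻¹ r := by
  have hdiff : Differentiable ℝ ψ := fun y => (hψ y).differentiableAt
  have hmono : Monotone fun y => ψ y - m * y := by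
    refine monotone_of_deriv_nonneg (hdiff.sub (differentiable_id.const_mul m)) fun y => ?_
    have := ((hψ y).sub ((hasDerivAt_id y).const_mul m)).deriv
    simp only [mul_one] at this
    rw [show (fun y => ψ y - m * y) = ψ - fun y => m * id y from rfl, this]
    linarith [hle y]
  have hstrict : StrictMono ψ := by
    intro x y hxy
    have h1 := hmono hxy.le
    simp only at h1
    nlinarith
  have hsurj : Function.Surjective ψ := by
    refine hdiff.continuous.surjective ?_ ?_
    · refine Filter.tendsto_atTop_mono' _ ?_ (Filter.tendsto_atTop_add_const_left _ (ψ 0)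
        (Filter.tendsto_id.const_mul_atTop hm))
      filter_upwards [Filter.eventually_ge_atTop 0] with y hy
      have := hmono hy
      simp only [mul_zero, sub_zero, id] at this ⊢
      linarith
    · refine Filter.tendsto_atBot_mono' _ ?_ (Filter.tendsto_atBot_add_const_left _ (ψ 0)
        (Filter.tendsto_id.const_mul_atBot hm))
      filter_upwards [Filter.eventually_le_atBot 0] with y hy
      have := hmono hy
      simp only [mul_zero, sub_zero, id] at this ⊢
      linarith
  let e := StrictMono.orderIsoOfSurjective ψ hstrict hsurj
  have he : ∀ r, ψ (e.symm r) = r := fun r => e.apply_symm_apply r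
  refine ⟨e.symm, fun y => e.symm_apply_apply y, he, fun r => ?_⟩
  exact HasDerivAt.of_local_left_inverse e.symm.continuous.continuousAt (hψ _)
    (hm.trans_le (hle _)).ne' (Filter.Eventually.of_forall he)

/-- The output equation `y + D φ(y) = r` of the loop has a differentiable solution `y = η(r)`: the
slopes `1 + D φ'(y)` lie between `1 + K₁ D` and `1 + K₂ D`, which have the same sign. -/
theorem exists_loop_solution {φ : ℝ → ℝ} {K₁ K₂ D : ℝ} (hK : K₁ < K₂)
    (hφ : DifferentialSector K₁ K₂ φ) (hD : 0 < (1 + K₁ * D) * (1 + K₂ * D)) :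
    ∃ η : ℝ → ℝ, (∀ y, η (y + D * φ y) = y) ∧ (∀ r, η r + D * φ (η r) = r) ∧
      ∀ r, HasDerivAt η (1 + D * deriv φ (η r))⁻¹ r ∧ 1 + D * deriv φ (η r) ≠ 0 := by
  have hmem : ∀ y, K₁ ≤ deriv φ y ∧ deriv φ y ≤ K₂ := by
    intro y
    have h1 := hφ.2 y 1
    simp only [mul_one] at h1
    constructor <;> nlinarith
  have hder : ∀ y, HasDerivAt (fun y => y + D * φ y) (1 + D * deriv φ y) y := fun y =>
    (hasDerivAt_id y).add ((hφ.1 y).hasDerivAt.const_mul D)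
  rcases pos_and_pos_or_neg_and_neg_of_mul_pos hD with ⟨h1, h2⟩ | ⟨h1, h2⟩
  · have hle : ∀ y, min (1 + K₁ * D) (1 + K₂ * D) ≤ 1 + D * deriv φ y := by
      intro y
      obtain ⟨h3, h4⟩ := hmem y
      rcases le_total 0 D with hD0 | hD0
      · exact (min_le_left _ _).trans (by nlinarith)
      · exact (min_le_right _ _).trans (by nlinarith)
    obtain ⟨η, hη1, hη2, hη3⟩ := exists_differentiable_inverse_of_le_deriv (lt_min h1 h2) hder hle
    exact ⟨η, hη1, hη2, fun r => ⟨hη3 r, ((lt_min h1 h2).trans_le (hle _)).ne'⟩⟩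
  · have hm : 0 < min (-(1 + K₁ * D)) (-(1 + K₂ * D)) := lt_min (by linarith) (by linarith)
    have hle : ∀ y, min (-(1 + K₁ * D)) (-(1 + K₂ * D)) ≤ -(1 + D * deriv φ y) := by
      intro y
      obtain ⟨h3, h4⟩ := hmem y
      rcases le_total 0 D with hD0 | hD0
      · exact (min_le_right _ _).trans (by nlinarith)
      · exact (min_le_left _ _).trans (by nlinarith)
    obtain ⟨η, hη1, hη2, hη3⟩ := exists_differentiable_inverse_of_le_deriv hm
      (fun y => (hder y).neg) hle
    refine ⟨fun r => η (-r), fun y => hη1 y, fun r => ?_, fun r => ⟨?_, ?_⟩⟩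
    · have := hη2 (-r)
      simp only [Pi.neg_apply] at this
      linarith
    · have h3 := (hη3 (-r)).comp r (hasDerivAt_neg r)
      rw [inv_neg, neg_mul_neg, mul_one] at h3
      exact h3
    · have := hm.trans_le (hle (η (-r)))
      intro h0
      rw [h0] at this
      simp at this

/-! ### Dominance of the Lur'e system -/

namespace SISOSystem

variable {n : ℕ}

/-- The circle condition is the frequency-domain inequality of the form `-(u + K₁ y)(u + K₂ y)`,
`y = C x + D u`, for the shifted system `ẋ = (A + l I) x + B u`. -/
theorem IsMinimal.exists_storage_of_circle_condition {S : SISOSystem n} (h : S.IsMinimal)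
    {K₁ K₂ l : ℝ} (hpoles : ∀ s ∈ frontier (nyquistRegion l), s ∉ S.poles)
    (hcirc : ∀ z ∈ S.nyquistPlot l,
      0 < 1 + (K₁ + K₂) * z.re + K₁ * K₂ * (z.re ^ 2 + z.im ^ 2)) :
    ∃ (P : Matrix (Fin n) (Fin n) ℝ) (ε : ℝ), P.IsSymm ∧ 0 < ε ∧
      ∀ (x : Fin n → ℝ) (u y : ℝ), y = S.C ⬝ᵥ x + S.D * u →
        2 * (x ⬝ᵥ (P *ᵥ (S.A *ᵥ x + u • S.B + l • x))) - (u + K₁ * y) * (u + K₂ * y)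
          ≤ -ε * (x ⬝ᵥ x) := by
  let F : Matrix (Fin n) (Fin n ⊕ Unit) ℝ :=
    Matrix.fromCols (S.A + l • (1 : Matrix (Fin n) (Fin n) ℝ)) (Matrix.replicateCol Unit S.B)
  let G : Matrix (Fin n) (Fin n ⊕ Unit) ℝ := Matrix.fromCols 1 0
  let c : ℝ → Fin n ⊕ Unit → ℝ := fun K => Sum.elim (K • S.C) fun _ => 1 + K * S.D
  have hF : ∀ (x : Fin n → ℝ) (u : ℝ),
      F *ᵥ Sum.elim x (fun _ => u) = S.A *ᵥ x + u • S.B + l • x := by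
    intro x u
    rw [Matrix.fromCols_mulVec, Matrix.add_mulVec, Matrix.smul_mulVec, Matrix.one_mulVec]
    ext i
    simp [Matrix.mulVec, dotProduct, mul_comm u]
    ring
  have hG : ∀ (x : Fin n → ℝ) (u : ℝ), G *ᵥ Sum.elim x (fun _ => u) = x := by
    intro x u
    simp [G, Matrix.fromCols_mulVec]
  have hFc : ∀ z : Fin n ⊕ Unit → ℂ, F.map Complex.ofReal *ᵥ z
      = S.A.map Complex.ofReal *ᵥ (z ∘ Sum.inl) + z (Sum.inr ()) • (Complex.ofReal ∘ S.B)
        + (l : ℂ) • (z ∘ Sum.inl) := by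
    intro z
    have h1 : F.map Complex.ofReal = Matrix.fromCols
        (S.A.map Complex.ofReal + (l : ℂ) • (1 : Matrix (Fin n) (Fin n) ℂ))
        (Matrix.replicateCol Unit (Complex.ofReal ∘ S.B)) := by
      ext i (j | j)
      · by_cases hij : i = j
        · subst hij; simp [F]
        · simp [F, hij]
      · simp [F]
    rw [h1, Matrix.fromCols_mulVec, Matrix.add_mulVec, Matrix.smul_mulVec, Matrix.one_mulVec]
    ext i
    simp [Matrix.mulVec, dotProduct, mul_comm (z (Sum.inr ()))]
    ring
  have hGc : ∀ z : Fin n ⊕ Unit → ℂ, G.map Complex.ofReal *ᵥ z = z ∘ Sum.inl := by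
    intro z
    have h1 : G.map Complex.ofReal = Matrix.fromCols (1 : Matrix (Fin n) (Fin n) ℂ)
        (0 : Matrix (Fin n) Unit ℂ) := by
      ext i (j | j)
      · by_cases hij : i = j
        · subst hij; simp [G]
        · simp [G, hij]
      · simp [G]
    rw [h1, Matrix.fromCols_mulVec]
    simp
  -- the value of the form in terms of `y = g u`
  have hform : ∀ (z : Fin n ⊕ Unit → ℂ) (g : ℂ), g ∈ S.nyquistPlot l → z (Sum.inr ()) ≠ 0 →
      (Complex.ofReal ∘ S.C) ⬝ᵥ (z ∘ Sum.inl) + S.D * z (Sum.inr ()) = g * z (Sum.inr ()) →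
      (star z ⬝ᵥ ((-Matrix.vecMulVec (c K₁) (c K₂)).map Complex.ofReal *ᵥ z)).re < 0 := by
    intro z g hg hu hy
    have hc : ∀ K : ℝ, (Complex.ofReal ∘ c K) ⬝ᵥ z = (1 + K * g) * z (Sum.inr ()) := by
      intro K
      have h1 : (Complex.ofReal ∘ c K) ⬝ᵥ z
          = K * ((Complex.ofReal ∘ S.C) ⬝ᵥ (z ∘ Sum.inl)) + (1 + K * S.D) * z (Sum.inr ()) := by
        simp [dotProduct, c, Finset.mul_sum, mul_assoc]
      rw [h1]
      linear_combination (K : ℂ) * hy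
    have h2 : star z ⬝ᵥ ((-Matrix.vecMulVec (c K₁) (c K₂)).map Complex.ofReal *ᵥ z)
        = -(star ((Complex.ofReal ∘ c K₁) ⬝ᵥ z) * ((Complex.ofReal ∘ c K₂) ⬝ᵥ z)) := by
      have h3 : (-Matrix.vecMulVec (c K₁) (c K₂)).map Complex.ofReal
          = -Matrix.vecMulVec (Complex.ofReal ∘ c K₁) (Complex.ofReal ∘ c K₂) := by
        ext i j
        simp [Matrix.vecMulVec_apply]
      have h4 : star (Complex.ofReal ∘ c K₁ : Fin n ⊕ Unit → ℂ) = Complex.ofReal ∘ c K₁ := by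
        ext i; simp
      rw [h3, Matrix.neg_mulVec, dotProduct_neg, Matrix.vecMulVec_mulVec, op_smul_eq_smul,
        dotProduct_smul, Matrix.star_dotProduct, h4, smul_eq_mul, mul_comm]
    have h5 : star ((1 + K₁ * g) * z (Sum.inr ())) * ((1 + K₂ * g) * z (Sum.inr ()))
        = (Complex.normSq (z (Sum.inr ())) : ℂ) * (star (1 + K₁ * g) * (1 + K₂ * g)) := by
      rw [Complex.normSq_eq_conj_mul_self, star_mul']
      simp only [← starRingEnd_apply]
      ring
    rw [h2, hc, hc, h5, Complex.neg_re, Complex.re_ofReal_mul, neg_lt_zero]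
    refine mul_pos (Complex.normSq_pos.2 hu) ?_
    have h6 := hcirc g hg
    have h7 : (star (1 + K₁ * g) * (1 + K₂ * g)).re
        = 1 + (K₁ + K₂) * g.re + K₁ * K₂ * (g.re ^ 2 + g.im ^ 2) := by
      simp
      ring
    rwa [h7]
  obtain ⟨P, ε, hP, hε, hPz⟩ := exists_storage_matrix F G (-Matrix.vecMulVec (c K₁) (c K₂)) (by
    intro z hz hfreq
    rw [hGc] at hfreq
    rcases hfreq with h0 | ⟨ω, hω⟩
    · have hu : z (Sum.inr ()) ≠ 0 := by
        intro hu
        apply hz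
        ext (i | i)
        · exact congrFun h0 i
        · exact hu
      exact hform z S.D ⟨none, rfl⟩ hu (by rw [h0]; simp)
    · rw [hFc] at hω
      have hstate : S.A.map Complex.ofReal *ᵥ (z ∘ Sum.inl)
          + z (Sum.inr ()) • (Complex.ofReal ∘ S.B)
          = (Complex.I * (ω : ℂ) - (l : ℂ)) • (z ∘ Sum.inl) := by
        rw [eq_sub_of_add_eq hω, sub_smul, mul_comm Complex.I]
      have hs := h.aeval_charpoly_ne_zero hpoles ω
      have hu : z (Sum.inr ()) ≠ 0 := by
        intro hu
        have h1 := S.charpoly_smul_state hstate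
        rw [hu, zero_smul, smul_eq_zero] at h1
        apply hz
        ext (i | i)
        · exact congrFun (h1.resolve_left hs) i
        · exact hu
      exact hform z _ ⟨some ω, rfl⟩ hu (h.output_eq hs hstate))
  refine ⟨P, ε, hP, hε, fun x u y hy => ?_⟩
  have h1 := hPz (Sum.elim x fun _ => u)
  rw [hF, hG, Matrix.neg_mulVec, Matrix.vecMulVec_mulVec, dotProduct_neg] at h1
  have hc : ∀ K : ℝ, c K ⬝ᵥ Sum.elim x (fun _ => u) = u + K * y := by
    intro K
    have h2 : c K ⬝ᵥ Sum.elim x (fun _ => u) = K * (S.C ⬝ᵥ x) + (1 + K * S.D) * u := by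
      simp only [c]
      rw [sumElim_dotProduct_sumElim, smul_dotProduct, smul_eq_mul]
      congr 1
      simp [dotProduct]
    rw [h2, hy]
    ring
  rw [hc] at h1
  have h2 : Sum.elim x (fun _ : Unit => u) ⬝ᵥ (MulOpposite.op (u + K₂ * y) • c K₁)
      = (u + K₁ * y) * (u + K₂ * y) := by
    rw [← hc K₁]
    simp [dotProduct_comm]
  rw [h2] at h1
  have h3 : Sum.elim x (fun _ : Unit => u) ⬝ᵥ Sum.elim x (fun _ => u) = x ⬝ᵥ x + u * u := by
    simp [dotProduct]
  rw [h3] at h1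
  nlinarith [mul_nonneg hε.le (mul_self_nonneg u)]

/-- The constant gain `K₁` satisfies the sector condition with equality, so its closed-loop matrix
is a Lyapunov pair with `P`, and the inertia of `P` is read off from its eigenvalues. -/
theorem IsMinimal.inertia_storage {S : SISOSystem n} (h : S.IsMinimal) {K₁ K₂ l ε : ℝ} {p : ℕ}
    (hK : K₁ ≠ 0) (hpoles : ∀ s ∈ frontier (nyquistRegion l), s ∉ S.poles)
    (hencircle : ClockwiseEncirclements (S.nyquistCurve l) ((-1 / K₁ : ℝ) : ℂ)
      ((p : ℤ) - (S.numPolesIn l : ℤ))) (hD : 1 + K₁ * S.D ≠ 0)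
    {P : Matrix (Fin n) (Fin n) ℝ} (hP : P.IsSymm) (hε : 0 < ε)
    (hPx : ∀ (x : Fin n → ℝ) (u y : ℝ), y = S.C ⬝ᵥ x + S.D * u →
        2 * (x ⬝ᵥ (P *ᵥ (S.A *ᵥ x + u • S.B + l • x))) - (u + K₁ * y) * (u + K₂ * y)
          ≤ -ε * (x ⬝ᵥ x)) :
    inertia P = (p, 0, n - p) := by
  classical
  have hcount := h.countP_closedLoop hK hpoles hencircle
  rw [add_sub_cancel, Nat.cast_inj] at hcount
  have hin := inertia_eq_of_lyapunov (S.A - (K₁ / (1 + K₁ * S.D)) • Matrix.vecMulVec S.B S.C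
      + l • (1 : Matrix (Fin n) (Fin n) ℝ)) P hP (by
    intro x hx
    set v := S.C ⬝ᵥ x with hv
    have h1 := hPx x (-(K₁ / (1 + K₁ * S.D) * v)) (v / (1 + K₁ * S.D)) (by
      field_simp
      ring)
    have h2 : (S.A - (K₁ / (1 + K₁ * S.D)) • Matrix.vecMulVec S.B S.C
        + l • (1 : Matrix (Fin n) (Fin n) ℝ)) *ᵥ x
        = S.A *ᵥ x + (-(K₁ / (1 + K₁ * S.D) * v)) • S.B + l • x := by
      rw [Matrix.add_mulVec, Matrix.sub_mulVec, Matrix.smul_mulVec, Matrix.smul_mulVec,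
        Matrix.one_mulVec, Matrix.vecMulVec_mulVec, op_smul_eq_smul, smul_smul, neg_smul,
        ← sub_eq_add_neg]
    have h3 : -(K₁ / (1 + K₁ * S.D) * v) + K₁ * (v / (1 + K₁ * S.D)) = 0 := by ring
    rw [h3, zero_mul, sub_zero, ← h2] at h1
    have h4 : 0 < x ⬝ᵥ x := by
      rw [← show star x = x from star_trivial x]
      exact Matrix.dotProduct_star_self_pos_iff.2 hx
    nlinarith [mul_pos hε h4])
  rw [hin, hcount]

end SISOSystem

theorem mainTheorem1 {n : ℕ} (S : SISOSystem n) (hmin : S.IsMinimal)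
    (φ : ℝ → ℝ) (K₁ K₂ l : ℝ) (hl : 0 ≤ l) (p : ℕ)
    (hsector : DifferentialSector K₁ K₂ φ)
    (hpoles : ∀ s ∈ frontier (nyquistRegion l), s ∉ S.poles)
    (hencircle : ClockwiseEncirclements (S.nyquistCurve l) ((-1 / K₁ : ℝ) : ℂ)
      ((p : ℤ) - (S.numPolesIn l : ℤ)))
    (hcircle :
      (0 < K₁ ∧ K₁ < K₂ ∧ S.nyquistPlot l ⊆ (circleDisc K₁ K₂)ᶜ) ∨
      (K₁ < 0 ∧ 0 < K₂ ∧ S.nyquistPlot l ⊆ interior (circleDisc K₁ K₂)) ∨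
      (K₁ < K₂ ∧ K₂ < 0 ∧ S.nyquistPlot l ⊆ (circleDisc K₁ K₂)ᶜ)) :
    ∃ f : (Fin n → ℝ) → (Fin n → ℝ),
      IsLureVectorField S φ f ∧ StrictlyDominant p l f := by
  obtain ⟨hK₁, hK, hcirc⟩ := circle_condition hcircle
  -- the circle condition at `ω = ∞`, where `G = D`
  have hD : 0 < (1 + K₁ * S.D) * (1 + K₂ * S.D) := by
    have h1 := hcirc S.D ⟨none, rfl⟩
    simp only [Complex.ofReal_re, Complex.ofReal_im] at h1
    linarith
  obtain ⟨η, hη1, hη2, hη3⟩ := exists_loop_solution hK hsector hD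
  obtain ⟨P, ε, hP, hε, hPx⟩ := hmin.exists_storage_of_circle_condition hpoles hcirc
  let f : (Fin n → ℝ) → (Fin n → ℝ) := fun x => S.A *ᵥ x + (-φ (η (S.C ⬝ᵥ x))) • S.B
  have hsol : ∀ (x : Fin n → ℝ) (y u : ℝ), y = S.C ⬝ᵥ x + S.D * u → u = -φ y →
      y = η (S.C ⬝ᵥ x) := by
    intro x y u hy hu
    rw [← hη1 y]
    congr 1
    rw [hu] at hy
    linarith
  -- the derivative of the loop input: the gain `-φ'(y)` applied to the differential output
  have hderiv : ∀ x : Fin n → ℝ, HasFDerivAt f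
      (S.A.mulVecLin.toContinuousLinearMap +
        ((-(deriv φ (η (S.C ⬝ᵥ x)) * (1 + S.D * deriv φ (η (S.C ⬝ᵥ x)))⁻¹)) •
          (dotProductBilin ℝ ℝ S.C).toContinuousLinearMap).smulRight S.B) x := by
    intro x
    have h1 : HasFDerivAt (fun x : Fin n → ℝ => S.C ⬝ᵥ x)
        (dotProductBilin ℝ ℝ S.C).toContinuousLinearMap x :=
      (dotProductBilin ℝ ℝ S.C).toContinuousLinearMap.hasFDerivAt
    have h2 : HasFDerivAt (fun x : Fin n → ℝ => S.A *ᵥ x)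
        S.A.mulVecLin.toContinuousLinearMap x :=
      S.A.mulVecLin.toContinuousLinearMap.hasFDerivAt
    have h3 := (((hsector.1 (η (S.C ⬝ᵥ x))).hasDerivAt.comp _ (hη3 (S.C ⬝ᵥ x)).1).neg).comp_hasFDerivAt
      x h1
    exact h2.add (h3.smul_const S.B)
  refine ⟨f, ⟨fun x => ⟨(η (S.C ⬝ᵥ x), -φ (η (S.C ⬝ᵥ x))), ⟨?_, rfl⟩, ?_⟩, ?_⟩,
    fun x => (hderiv x).differentiableAt, P, ε, hP,
    hmin.inertia_storage hK₁ hpoles hencircle (left_ne_zero_of_mul hD.ne') hP hε hPx, hε, ?_⟩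
  · have := hη2 (S.C ⬝ᵥ x)
    simp only
    linarith
  · rintro ⟨y, u⟩ ⟨hy, hu⟩
    simp only at hy hu
    have h1 := hsol x y u hy hu
    rw [hu, h1]
  · intro x y u hy hu
    rw [hu, hsol x y u hy hu]
  · intro x dx
    set y := η (S.C ⬝ᵥ x)
    obtain ⟨-, hne⟩ := hη3 (S.C ⬝ᵥ x)
    -- the differential output and input
    set dy := (1 + S.D * deriv φ y)⁻¹ * (S.C ⬝ᵥ dx) with hdy
    set du := -(deriv φ y * dy) with hdu
    have hdxdot : fderiv ℝ f x dx = S.A *ᵥ dx + du • S.B := by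
      rw [(hderiv x).fderiv]
      simp [hdu, hdy, y, mul_assoc]
    have hloop : dy = S.C ⬝ᵥ dx + S.D * du := by
      have h1 : (1 + S.D * deriv φ y) * dy = S.C ⬝ᵥ dx := by
        rw [hdy, mul_inv_cancel_left₀ hne]
      rw [hdu]
      linarith
    have h1 := hPx dx du dy hloop
    have h2 := hsector.2 y dy
    have h3 : (du + K₁ * dy) * (du + K₂ * dy)
        = (deriv φ y * dy - K₁ * dy) * (deriv φ y * dy - K₂ * dy) := by rw [hdu]; ring
    rw [hdxdot]
    generalize S.A *ᵥ dx + du • S.B = w at *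
    have hsymm : w ⬝ᵥ (P *ᵥ dx) = dx ⬝ᵥ (P *ᵥ w) := by
      rw [Matrix.dotProduct_mulVec, ← Matrix.mulVec_transpose, hP.eq, dotProduct_comm]
    rw [Matrix.fromBlocks_mulVec]
    simp only [Sum.elim_comp_inl, Sum.elim_comp_inr, Matrix.zero_mulVec, zero_add,
      Matrix.add_mulVec, Matrix.smul_mulVec, Matrix.one_mulVec, sumElim_dotProduct_sumElim,
      dotProduct_add, dotProduct_smul, smul_eq_mul, hsymm]
    simp only [Matrix.mulVec_add, Matrix.mulVec_smul, dotProduct_add, dotProduct_smul,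
      smul_eq_mul] at h1
    linarith
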